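/- **Notation.** Let $m,k\in\mathbb C$ and $Q\in L^1_{\mathrm{loc}}]0,\infty[$ (complex-valued). Put $L^0_{m^2}=-\partial_x^2+(m^2-\tfrac14)x^{-2}$ and $L_{m^2}=L^0_{m^2}+Q(x)$. Let $AC^1]0,\infty[$ be the set of $C^1$ functions $f:]0,\infty[\to\mathbb C$ whose derivative is locally absolutely continuous, and let $\mathcal N(L^0_{m^2}+k^2)$ be the space of all $g^0\in AC^1]0,\infty[$ with $L^0_{m^2}g^0=-k^2g^0$. For $\varepsilon,\beta\ge 0$ write $Q\in\mathscr L^{(0)}_{\varepsilon}$ if $\int_0^1x^{1-\varepsilon}|Q(x)|\,dx<\infty$, and $Q\in\mathscr L^{(0)}_{\varepsilon,\ln^\beta}$ if $\int_0^1x^{1-\varepsilon}(1+|\ln x|^\beta)|Q(x)|\,dx<\infty$. Let $G^0_\to$ be the forward Green's operator of $L^0_{m^2}+k^2$, with kernel $$G^0_\to(x,y)=\theta(x-y)\,\frac{h_1(x)h_2(y)-h_2(x)h_1(y)}{h_1h_2'-h_1'h_2},$$ where $h_1,h_2$ is any basis of $\mathcal N(L^0_{m^2}+k^2)$ (the kernel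 does not depend on the basis) and $\theta$ is the Heaviside function; thus $(G^0_\to Qf)(x)=\int_0^xG^0_\to(x,y)Q(y)f(y)\,dy$. For a positive function $\phi$ let $L^\infty(]0,a[,\phi)$ be the space of (classes of) measurable $f$ on $]0,a[$ with $\operatorname{ess\,sup}_{0<x<a}|f(x)|/\phi(x)<\infty$. By $g=(1+G^0_\to Q)^{-1}g^0$, relative to a weight $\phi$ on $]0,\infty[$, we mean: for every $a>0$, $G^0_\to Q$ is given on $L^\infty(]0,a[,\phi)$ by absolutely convergent integrals and is bounded there, $1+G^0_\to Q$ has a bounded inverse on $L^\infty(]0,a[,\phi)$, the restrictions of $g^0$ and $g$ to $]0,a[$ belong to this space, and $g+G^0_\to Qg=g^0$ on $]0,\infty[$. **Theorem.** Let $\operatorname{Re}(k)\ge0$. 1. Suppose $\operatorname{Re}(m)\ge0$, $m\ne0$, $\varepsilon\ge0$ and $Q\in\mathscr L^{(0)}_\varepsilon$. Let $g^0\in\mathcal N(L^0_{m^2}+k^2)$ with $g^0=\mathcal O(x^{\frac12+\operatorname{Re}(m)})$ as $x\to0$. Then $g:=(1+G^0_\to Q)^{-1}g^0$ (with $\phi=x^{\frac12+\operatorname{Re}(m)}$)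 exists and is the unique solution in $AC^1]0,\infty[$ of $L_{m^2}g=-k^2g$ such that, as $x\to0$, $$g-g^0=o(x^{\frac12+\operatorname{Re}(m)+\varepsilon}),\qquad \partial_xg-\partial_xg^0=o(x^{-\frac12+\operatorname{Re}(m)+\varepsilon}).$$ 2. Suppose $m=0$, $\varepsilon\ge0$ and $Q\in\mathscr L^{(0)}_{\varepsilon,\ln}$. Let $g^0\in\mathcal N(L^0_{0}+k^2)$ with $g^0=\mathcal O(x^{\frac12})$ as $x\to0$. Then $g:=(1+G^0_\to Q)^{-1}g^0$ (with $\phi=x^{\frac12}$) exists and is the unique solution in $AC^1]0,\infty[$ of $L_{0}g=-k^2g$ such that, as $x\to0$, $$g-g^0=o(x^{\frac12+\varepsilon}),\qquad \partial_xg-\partial_xg^0=o(x^{-\frac12+\varepsilon}).$$ 3. Suppose $\operatorname{Re}(m)\ge0$, $m\ne0$, $\varepsilon\ge2\operatorname{Re}(m)$ and $Q\in\mathscr L^{(0)}_\varepsilon$. Let $g^0\in\mathcal N(L^0_{m^2}+k^2)$ be arbitrary. Then $g:=(1+G^0_\to Q)^{-1}g^0$ (with $\phi=x^{\frac12-\operatorname{Re}(m)}$)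 exists and is the unique solution in $AC^1]0,\infty[$ of $L_{m^2}g=-k^2g$ such that, as $x\to0$, $$g-g^0=o(x^{\frac12-\operatorname{Re}(m)+\varepsilon}),\qquad \partial_xg-\partial_xg^0=o(x^{-\frac12-\operatorname{Re}(m)+\varepsilon}).$$ 4. Suppose $m=0$, $\varepsilon\ge0$ and $Q\in\mathscr L^{(0)}_{\varepsilon,\ln^2}$. Let $g^0\in\mathcal N(L^0_{0}+k^2)$ be arbitrary. Then $g:=(1+G^0_\to Q)^{-1}g^0$ (with $\phi=x^{\frac12}(1+|\ln x|)$) exists and is the unique solution in $AC^1]0,\infty[$ of $L_{0}g=-k^2g$ such that, as $x\to0$, $$g-g^0=o(x^{\frac12+\varepsilon}),\qquad \partial_xg-\partial_xg^0=o(x^{-\frac12+\varepsilon}).$$ -/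

import Mathlib

open MeasureTheory Set Filter Topology Asymptotics
open scoped ENNReal

noncomputable section

namespace PerturbedBessel

/-! All functions live on the half-line `]0,∞[`, represented as functions `ℝ → ℂ` whose values on
`]-∞,0]` play no role. -/

/-- `AC]0,∞[`: functions that are absolutely continuous on every compact interval in `]0,∞[`. -/
def IsAC (f : ℝ → ℂ) : Prop :=
  ∀ a b : ℝ, 0 < a → 0 < b → AbsolutelyContinuousOnInterval f a b

/-- `AC¹]0,∞[`: differentiable functions on `]0,∞[` whose derivative belongs to `AC]0,∞[`. -/
def IsAC1 (f : ℝ → ℂ) : Prop :=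
  (∀ x : ℝ, 0 < x → DifferentiableAt ℝ f x) ∧ IsAC (deriv f)

/-- The expression `L_{m²} f = -f'' + (m² - 1/4) x⁻² f + Q f`; the unperturbed expression
`L⁰_{m²}` is the case `Q = 0`. -/
def besselExpr (m : ℂ) (Q : ℝ → ℂ) (f : ℝ → ℂ) (x : ℝ) : ℂ :=
  -deriv (deriv f) x + (m ^ 2 - 1 / 4) * (1 / (x : ℂ) ^ 2) * f x + Q x * f x

/-- `f ∈ AC¹]0,∞[` and `L_{m²} f = -k² f` (an identity in `L¹_loc]0,∞[`, i.e. almost everywhere).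
For `Q = 0` this is membership of `f` in the null space of `L⁰_{m²} + k²`. -/
def IsSolution (m k : ℂ) (Q : ℝ → ℂ) (f : ℝ → ℂ) : Prop :=
  IsAC1 f ∧ ∀ᵐ x ∂(volume.restrict (Ioi (0 : ℝ))), besselExpr m Q f x = -k ^ 2 * f x

/-- The Wronskian `W(f, g; x)`. -/
def wronskian (f g : ℝ → ℂ) (x : ℝ) : ℂ :=
  f x * deriv g x - deriv f x * g x

/-- A pair of solutions of the unperturbed equation `L⁰_{m²} h = -k² h` with non-zero Wronskian.
(The Wronskian of two solutions is constant on `]0,∞[`; it is evaluated at `1`.) -/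
def IsFundamentalPair (m k : ℂ) (h : (ℝ → ℂ) × (ℝ → ℂ)) : Prop :=
  IsSolution m k 0 h.1 ∧ IsSolution m k 0 h.2 ∧ wronskian h.1 h.2 1 ≠ 0

/-- A chosen fundamental pair of the unperturbed equation. -/
def fundamentalPair (m k : ℂ) : (ℝ → ℂ) × (ℝ → ℂ) :=
  Classical.epsilon (IsFundamentalPair m k)

/-- The kernel `G⁰_↔(x,y)` of the canonical bisolution of `L⁰_{m²} + k²`. It does not depend on
the choice of the fundamental pair. -/
def canonicalBisolution (m k : ℂ) (x y : ℝ) : ℂ :=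
  ((fundamentalPair m k).1 x * (fundamentalPair m k).2 y
    - (fundamentalPair m k).2 x * (fundamentalPair m k).1 y)
    / wronskian (fundamentalPair m k).1 (fundamentalPair m k).2 1

/-- The kernel `G⁰_→(x,y) = θ(x - y) G⁰_↔(x,y)` of the forward Green's operator. -/
def forwardGreen (m k : ℂ) (x y : ℝ) : ℂ :=
  if y ≤ x then canonicalBisolution m k x y else 0

/-- The operator `G⁰_→ Q`, that is `(G⁰_→ Q f)(x) = ∫₀^∞ G⁰_→(x,y) Q(y) f(y) dy`. -/
def greenQ (m k : ℂ) (Q : ℝ → ℂ) (f : ℝ → ℂ) (x : ℝ) : ℂ :=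
  ∫ y in Ioi (0 : ℝ), forwardGreen m k x y * (Q y * f y)

/-- The class `ℒ⁽⁰⁾_ε`: `Q ∈ L¹_loc]0,∞[` and `∫₀¹ x^{1-ε} |Q(x)| dx < ∞`. -/
def potentialClass (ε : ℝ) : Set (ℝ → ℂ) :=
  {Q | LocallyIntegrableOn Q (Ioi (0 : ℝ)) volume ∧
    IntegrableOn (fun x : ℝ => x ^ (1 - ε) * ‖Q x‖) (Ioo (0 : ℝ) 1) volume}

/-- The class `ℒ⁽⁰⁾_{ε,ln^β}`: `Q ∈ L¹_loc]0,∞[` and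
`∫₀¹ x^{1-ε} (1 + |ln x|^β) |Q(x)| dx < ∞`. -/
def logPotentialClass (ε β : ℝ) : Set (ℝ → ℂ) :=
  {Q | LocallyIntegrableOn Q (Ioi (0 : ℝ)) volume ∧
    IntegrableOn (fun x : ℝ => x ^ (1 - ε) * (1 + |Real.log x| ^ β) * ‖Q x‖)
      (Ioo (0 : ℝ) 1) volume}

/-- The norm `‖f / φ‖_∞` on `]0,a[` (a value in `[0,∞]`). -/
def weightedNorm (a : ℝ) (φ : ℝ → ℝ) (f : ℝ → ℂ) : ℝ≥0∞ :=
  eLpNorm (fun x => f x / (φ x : ℂ)) ∞ (volume.restrict (Ioo (0 : ℝ) a))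

/-- The functions representing elements of the weighted space `L^∞(]0,a[, φ)`: measurable with
`‖f / φ‖_∞ < ∞`. Two functions represent the same element iff they agree a.e. on `]0,a[`. -/
def weightedLinfty (a : ℝ) (φ : ℝ → ℝ) : Set (ℝ → ℂ) :=
  {f | MemLp (fun x => f x / (φ x : ℂ)) ∞ (volume.restrict (Ioo (0 : ℝ) a))}

/-- `1 + G⁰_→ Q` is a well-defined bounded operator on `L^∞(]0,a[, φ)` with a bounded inverse. -/
structure OneAddGreenInvertible (m k : ℂ) (Q : ℝ → ℂ) (a : ℝ) (φ : ℝ → ℝ) : Prop where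
  /-- the integrals defining `G⁰_→ Q f` on `]0,a[` converge absolutely -/
  integrable : ∀ f ∈ weightedLinfty a φ, ∀ x ∈ Ioo (0 : ℝ) a,
    IntegrableOn (fun y => forwardGreen m k x y * (Q y * f y)) (Ioi (0 : ℝ)) volume
  /-- `G⁰_→ Q` maps the space to itself -/
  mapsTo : ∀ f ∈ weightedLinfty a φ, greenQ m k Q f ∈ weightedLinfty a φ
  /-- `G⁰_→ Q` is bounded -/
  bounded : ∃ C : ℝ≥0∞, C ≠ ∞ ∧ ∀ f ∈ weightedLinfty a φ,
    weightedNorm a φ (greenQ m k Q f) ≤ C * weightedNorm a φ f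
  /-- `1 + G⁰_→ Q` is onto -/
  surjective : ∀ f ∈ weightedLinfty a φ, ∃ h ∈ weightedLinfty a φ,
    ∀ᵐ x ∂(volume.restrict (Ioo (0 : ℝ) a)), h x + greenQ m k Q h x = f x
  /-- `1 + G⁰_→ Q` is one-to-one with bounded inverse -/
  bounded_inverse : ∃ C : ℝ≥0∞, C ≠ ∞ ∧ ∀ h ∈ weightedLinfty a φ,
    weightedNorm a φ h ≤ C * weightedNorm a φ (fun x => h x + greenQ m k Q h x)

/-- `g = (1 + G⁰_→ Q)⁻¹ g⁰` on the whole of `]0,∞[`: for every `a > 0` the operator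
`1 + G⁰_→ Q` is invertible on `L^∞(]0,a[, φ)`, the restrictions of `g⁰` and `g` to `]0,a[` belong
to this space, and the inverse sends the first to the second. The last identity is required at
every point of `]0,∞[`, so that `g` itself, not only its class, is determined on `]0,∞[`. -/
structure IsInverseImage (m k : ℂ) (Q : ℝ → ℂ) (φ : ℝ → ℝ) (g₀ g : ℝ → ℂ) : Prop where
  invertible : ∀ a : ℝ, 0 < a → OneAddGreenInvertible m k Q a φ
  mem₀ : ∀ a : ℝ, 0 < a → g₀ ∈ weightedLinfty a φ
  mem : ∀ a : ℝ, 0 < a → g ∈ weightedLinfty a φ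
  eq : ∀ x : ℝ, 0 < x → g x + greenQ m k Q g x = g₀ x

/-- `g - g⁰ = o(x^σ)` and `g' - g⁰' = o(x^{σ-1})` as `x → 0`. -/
def MatchesNearZero (g₀ : ℝ → ℂ) (σ : ℝ) (g : ℝ → ℂ) : Prop :=
  (fun x => g x - g₀ x) =o[𝓝[>] (0 : ℝ)] (fun x => x ^ σ) ∧
  (fun x => deriv g x - deriv g₀ x) =o[𝓝[>] (0 : ℝ)] (fun x => x ^ (σ - 1))

/-- `g` is the unique solution in `AC¹]0,∞[` of `L_{m²} g = -k² g` such that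
`g - g⁰ = o(x^σ)` and `g' - g⁰' = o(x^{σ-1})` as `x → 0`. -/
def IsUniqueMatchingSolution (m k : ℂ) (Q : ℝ → ℂ) (g₀ : ℝ → ℂ) (σ : ℝ) (g : ℝ → ℂ) : Prop :=
  IsSolution m k Q g ∧ MatchesNearZero g₀ σ g ∧
    ∀ f : ℝ → ℂ, IsSolution m k Q f → MatchesNearZero g₀ σ f → EqOn f g (Ioi (0 : ℝ))

end PerturbedBessel

end

/-! For `k = 0` and `Q = 0` the equation has the explicit solutions `x ^ (1/2 ± m)`, or `x ^ (1/2)`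
and `x ^ (1/2) log x` if `m = 0`, and its bisolution satisfies `|G(x, y)| ≤ C ω(y) η(x)` for
`y ≤ x < a`, where `ω` and `η` are the sizes of the dominant and of the principal solution at `0`.
Since `ω η` is integrable near `0`, treating `k ^ 2` as a perturbation carries this bound over to
all `k`. If `φ` dominates `η` and `ω φ |Q|` is integrable near `0`, then `G⁰_→ Q` is a Volterra
operator on `L^∞(]0,a[, φ)`, so its Neumann series converges, and it sends `g` to a function
bounded by `C η(x) ∫₀ˣ ω φ |Q|`; the weight `x ^ (-ε)` in the class of `Q` makes this
`o(η(x) x ^ ε)`. For uniqueness, the difference `d` of two solutions is `o(η)`, and so is the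
solution `d + G Q d` of the `k = 0` equation, `G` being its forward Green's operator and `Q`
including `k ^ 2`. The Wronskian of this solution with the principal one vanishes, so it is a
multiple of the principal solution, hence zero, and `1 + G Q` is injective. -/

namespace PerturbedBessel

/-! ### Absolutely continuous functions -/

theorem absolutelyContinuousOnInterval_of_dist_le {X Y : Type*} [PseudoMetricSpace X]
    [PseudoMetricSpace Y] {F : ℝ → X} {G : ℝ → Y} {a b : ℝ}
    (hG : AbsolutelyContinuousOnInterval G a b)
    (h : ∀ x ∈ uIcc a b, ∀ y ∈ uIcc a b, dist (F x) (F y) ≤ dist (G x) (G y)) :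
    AbsolutelyContinuousOnInterval F a b := by
  rw [absolutelyContinuousOnInterval_iff] at hG ⊢
  intro ε hε
  obtain ⟨δ, hδ, H⟩ := hG ε hε
  exact ⟨δ, hδ, fun E hE hlen => (Finset.sum_le_sum fun i hi =>
    h _ (hE.1 i hi).1 _ (hE.1 i hi).2).trans_lt (H E hE hlen)⟩

theorem absolutelyContinuousOnInterval_integral {F : Type*} [NormedAddCommGroup F]
    [NormedSpace ℝ F] {f : ℝ → F} {a b c : ℝ} (h : IntervalIntegrable f volume a b)
    (hc : c ∈ uIcc a b) : AbsolutelyContinuousOnInterval (fun x => ∫ t in c..x, f t) a b := by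
  refine absolutelyContinuousOnInterval_of_dist_le
    (h.norm.absolutelyContinuousOnInterval_intervalIntegral hc) fun x hx y hy => ?_
  have hcx := h.mono_set (uIcc_subset_uIcc hc hx)
  have hcy := h.mono_set (uIcc_subset_uIcc hc hy)
  rw [dist_eq_norm, dist_eq_norm, intervalIntegral.integral_interval_sub_left hcx hcy,
    intervalIntegral.integral_interval_sub_left hcx.norm hcy.norm]
  exact intervalIntegral.norm_integral_le_abs_integral_norm

theorem absolutelyContinuousOnInterval_sub_eq_integral {E : Type*} [NormedAddCommGroup E]
    [NormedSpace ℝ E] [CompleteSpace E] {F f : ℝ → E} {a b : ℝ}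
    (hF : AbsolutelyContinuousOnInterval F a b) (hf : IntervalIntegrable f volume a b)
    (hd : ∀ᵐ x, x ∈ uIcc a b → HasDerivAt F (f x) x) :
    F b - F a = ∫ t in a..b, f t := by
  have hsub := hF.sub (absolutelyContinuousOnInterval_integral hf (c := a) left_mem_uIcc)
  obtain ⟨C, hC⟩ := hsub.const_of_ae_hasDerivAt_zero (by
    filter_upwards [hd, hf.ae_hasDerivAt_integral] with x hx hx' hxm
    simpa using (hx hxm).sub (hx' hxm a left_mem_uIcc))
  have ha := hC a left_mem_uIcc
  have hb := hC b right_mem_uIcc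
  simp only [Pi.sub_apply, intervalIntegral.integral_same, sub_zero] at ha hb
  rw [ha, ← hb, sub_sub_cancel]

theorem integral_mul_comp_primitive {ρ G g : ℝ → ℝ} {c x : ℝ}
    (hρ : IntervalIntegrable ρ volume c x) (hG : ∀ r, HasDerivAt G (g r) r) (hg : Continuous g) :
    IntervalIntegrable (fun y => ρ y * g (∫ t in c..y, ρ t)) volume c x ∧
      ∫ y in c..x, ρ y * g (∫ t in c..y, ρ t) = G (∫ t in c..x, ρ t) - G 0 := by
  have hac := hρ.absolutelyContinuousOnInterval_intervalIntegral (c := c) left_mem_uIcc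
  have hint : IntervalIntegrable (fun y => ρ y * g (∫ t in c..y, ρ t)) volume c x :=
    hρ.mul_continuousOn (hg.comp_continuousOn hac.continuousOn)
  obtain ⟨r, hr⟩ := hac.exists_bound
  have hGr : ContDiffOn ℝ 1 G (Metric.closedBall 0 r) :=
    (contDiff_one_iff_deriv.2 ⟨fun r => (hG r).differentiableAt,
      by rwa [show deriv G = g from funext fun r => (hG r).deriv]⟩).contDiffOn
  obtain ⟨K, hK⟩ := hGr.exists_lipschitzOnWith one_ne_zero (convex_closedBall 0 r)
    (isCompact_closedBall 0 r)
  have hcomp : AbsolutelyContinuousOnInterval (fun y => G (∫ t in c..y, ρ t)) c x := by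
    refine absolutelyContinuousOnInterval_of_dist_le (hac.const_mul (K : ℝ)) fun y hy z hz => ?_
    rw [← smul_eq_mul, ← smul_eq_mul, dist_smul₀, Real.norm_of_nonneg K.coe_nonneg]
    exact hK.dist_le_mul _ (mem_closedBall_zero_iff.2 (hr y hy)) _
      (mem_closedBall_zero_iff.2 (hr z hz))
  refine ⟨hint, ?_⟩
  rw [← absolutelyContinuousOnInterval_sub_eq_integral hcomp hint,
    intervalIntegral.integral_same]
  filter_upwards [hρ.ae_hasDerivAt_integral] with y hy hym
  rw [mul_comm]
  exact (hG _).comp y (hy hym c left_mem_uIcc)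

theorem uIcc_subset_Ioi_zero {a b : ℝ} (ha : 0 < a) (hb : 0 < b) : uIcc a b ⊆ Ioi (0 : ℝ) :=
  fun _ hx => lt_of_lt_of_le (lt_min ha hb) hx.1

theorem ae_restrict_Ioi_of_forall_uIcc {p : ℝ → Prop}
    (h : ∀ a b : ℝ, 0 < a → 0 < b → ∀ᵐ x, x ∈ uIcc a b → p x) :
    ∀ᵐ x ∂(volume.restrict (Ioi (0 : ℝ))), p x := by
  refine ae_restrict_of_ae_restrict_inter_Ioo fun a b ha hb _ => ?_
  rw [ae_restrict_iff' (measurableSet_Ioi.inter measurableSet_Ioo)]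
  filter_upwards [h a b ha hb] with x hx hxm
  exact hx (Icc_subset_uIcc (Ioo_subset_Icc_self hxm.2))

section IsAC

variable {f g F : ℝ → ℂ}

theorem IsAC.congr (hf : IsAC f) (h : EqOn f g (Ioi 0)) : IsAC g := fun a b ha hb =>
  absolutelyContinuousOnInterval_of_dist_le (hf a b ha hb) fun x hx y hy => by
    rw [h (uIcc_subset_Ioi_zero ha hb hx), h (uIcc_subset_Ioi_zero ha hb hy)]

theorem IsAC.add (hf : IsAC f) (hg : IsAC g) : IsAC (fun x => f x + g x) :=
  fun a b ha hb => (hf a b ha hb).add (hg a b ha hb)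

theorem IsAC.sub (hf : IsAC f) (hg : IsAC g) : IsAC (fun x => f x - g x) :=
  fun a b ha hb => (hf a b ha hb).sub (hg a b ha hb)

theorem IsAC.mul (hf : IsAC f) (hg : IsAC g) : IsAC (fun x => f x * g x) :=
  fun a b ha hb => (hf a b ha hb).smul (hg a b ha hb)

theorem IsAC.const_mul (hf : IsAC f) (c : ℂ) : IsAC (fun x => c * f x) :=
  fun a b ha hb => (hf a b ha hb).const_smul c

theorem IsAC.continuousOn (hf : IsAC f) : ContinuousOn f (Ioi 0) := by
  intro x (hx : 0 < x)
  have h := (hf (x / 2) (x + 1) (by positivity) (by positivity)).continuousOn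
  rw [uIcc_of_le (by linarith)] at h
  exact (h.continuousAt (Icc_mem_nhds (by linarith) (by linarith))).continuousWithinAt

theorem IsAC.ae_differentiableAt (hf : IsAC f) :
    ∀ᵐ x ∂(volume.restrict (Ioi (0 : ℝ))), DifferentiableAt ℝ f x :=
  ae_restrict_Ioi_of_forall_uIcc fun a b ha hb =>
    (hf a b ha hb).boundedVariationOn.ae_differentiableAt_of_mem_uIcc

theorem IsAC.sub_eq_integral (hF : IsAC F)
    (hd : ∀ᵐ x ∂(volume.restrict (Ioi (0 : ℝ))), HasDerivAt F (f x) x) {a b : ℝ} (ha : 0 < a)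
    (hb : 0 < b) (hf : IntervalIntegrable f volume a b) :
    F b - F a = ∫ t in a..b, f t := by
  refine absolutelyContinuousOnInterval_sub_eq_integral (hF a b ha hb) hf ?_
  rw [ae_restrict_iff' measurableSet_Ioi] at hd
  filter_upwards [hd] with x hx hxm using hx (uIcc_subset_Ioi_zero ha hb hxm)

theorem isAC_of_hasDerivAt {f' : ℝ → ℂ} (h : ∀ x, 0 < x → HasDerivAt f (f' x) x)
    (hf' : ContinuousOn f' (Ioi 0)) : IsAC f := by
  intro a b ha hb
  obtain ⟨C, hC⟩ := isCompact_uIcc.exists_bound_of_continuousOn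
    (hf'.mono (uIcc_subset_Ioi_zero ha hb))
  have hLip : LipschitzOnWith (Real.toNNReal C) f (uIcc a b) :=
    (convex_uIcc a b).lipschitzOnWith_of_nnnorm_hasDerivWithin_le
      (fun x hx => (h x (uIcc_subset_Ioi_zero ha hb hx)).hasDerivWithinAt)
      fun x hx => NNReal.coe_le_coe.1 ((hC x hx).trans (Real.le_coe_toNNReal C))
  exact hLip.absolutelyContinuousOnInterval

theorem IsAC.hasDerivAt_of_continuousOn (hF : IsAC F)
    (hd : ∀ᵐ x ∂(volume.restrict (Ioi (0 : ℝ))), HasDerivAt F (f x) x)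
    (hf : ContinuousOn f (Ioi 0)) {x : ℝ} (hx : 0 < x) : HasDerivAt F (f x) x := by
  have hint : ∀ b, 0 < b → IntervalIntegrable f volume x b := fun b hb =>
    (hf.mono (uIcc_subset_Ioi_zero hx hb)).intervalIntegrable
  have hprim : HasDerivAt (fun u => ∫ t in x..u, f t) (f x) x :=
    intervalIntegral.integral_hasDerivAt_right (hint x hx)
      (hf.stronglyMeasurableAtFilter isOpen_Ioi x hx) (hf.continuousAt (Ioi_mem_nhds hx))
  refine (hprim.const_add (F x)).congr_of_eventuallyEq ?_
  filter_upwards [Ioi_mem_nhds hx] with b hb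
  rw [← hF.sub_eq_integral hd hx hb (hint b hb), add_sub_cancel]

theorem isAC_integral {u : ℝ → ℂ} {c : ℝ} (hu : ∀ x, 0 < x → IntervalIntegrable u volume c x) :
    IsAC (fun x => ∫ y in c..x, u y) := fun a b ha hb =>
  absolutelyContinuousOnInterval_of_dist_le
    (absolutelyContinuousOnInterval_integral ((hu a ha).symm.trans (hu b hb)) left_mem_uIcc)
    fun x hx y hy => by
      have hx' := hu x (uIcc_subset_Ioi_zero ha hb hx)
      have hy' := hu y (uIcc_subset_Ioi_zero ha hb hy)
      have ha' := (hu a ha).symm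
      rw [dist_eq_norm, dist_eq_norm, intervalIntegral.integral_interval_sub_left hx' hy',
        intervalIntegral.integral_interval_sub_left (ha'.trans hx') (ha'.trans hy')]

theorem ae_hasDerivAt_integral {u : ℝ → ℂ} {c : ℝ}
    (hu : ∀ x, 0 < x → IntervalIntegrable u volume c x) :
    ∀ᵐ x ∂(volume.restrict (Ioi (0 : ℝ))), HasDerivAt (fun x => ∫ y in c..x, u y) (u x) x := by
  refine ae_restrict_Ioi_of_forall_uIcc fun a b ha hb => ?_
  filter_upwards [((hu a ha).symm.trans (hu b hb)).ae_hasDerivAt_integral] with x hx hxm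
  refine ((hx hxm a left_mem_uIcc).const_add (∫ y in c..a, u y)).congr_of_eventuallyEq ?_
  filter_upwards [Ioi_mem_nhds (uIcc_subset_Ioi_zero ha hb hxm)] with y hy
  exact (intervalIntegral.integral_add_adjacent_intervals (hu a ha)
    ((hu a ha).symm.trans (hu y hy))).symm

end IsAC

/-! ### Volterra integral equations -/

/-- The function `x ↦ |∫_c^x ρ|` that measures the growth of the solutions of a Volterra
equation with base point `c`. -/
noncomputable def absPrimitive (c : ℝ) (ρ : ℝ → ℝ) (x : ℝ) : ℝ := |∫ t in c..x, ρ t|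

theorem absPrimitive_nonneg (c : ℝ) (ρ : ℝ → ℝ) (x : ℝ) : 0 ≤ absPrimitive c ρ x := abs_nonneg _

theorem absPrimitive_mono {ρ : ℝ → ℝ} {c x y : ℝ} (hρ : IntervalIntegrable ρ volume c x)
    (h0 : ∀ y ∈ uIoc c x, 0 ≤ ρ y) (hy : y ∈ uIoc c x) :
    absPrimitive c ρ y ≤ absPrimitive c ρ x :=
  intervalIntegral.abs_integral_mono_interval
    (uIoc_subset_uIoc_of_uIcc_subset_uIcc (uIcc_subset_uIcc_left (uIoc_subset_uIcc hy)))
    (ae_restrict_of_forall_mem measurableSet_uIoc h0) hρ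

theorem absPrimitive_eq_integral {ρ : ℝ → ℝ} {c x : ℝ} (hcx : c ≤ x)
    (h0 : ∀ y ∈ Ioc c x, 0 ≤ ρ y) : absPrimitive c ρ x = ∫ t in c..x, ρ t := by
  refine abs_of_nonneg ?_
  rw [intervalIntegral.integral_of_le hcx]
  exact setIntegral_nonneg measurableSet_Ioc h0

theorem absPrimitive_eq_integral_neg {ρ : ℝ → ℝ} {c x : ℝ} (hxc : x ≤ c)
    (h0 : ∀ y ∈ Ioc x c, 0 ≤ ρ y) : absPrimitive c ρ x = ∫ t in c..x, -ρ t := by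
  have hn : 0 ≤ ∫ t in x..c, ρ t := by
    rw [intervalIntegral.integral_of_le hxc]
    exact setIntegral_nonneg measurableSet_Ioc h0
  rw [absPrimitive, intervalIntegral.integral_neg, intervalIntegral.integral_symm, abs_neg,
    neg_neg, abs_of_nonneg hn]

theorem integral_mul_comp_absPrimitive {ρ G g : ℝ → ℝ} {c x : ℝ}
    (hρ : IntervalIntegrable ρ volume c x) (h0 : ∀ y ∈ uIoc c x, 0 ≤ ρ y)
    (hG : ∀ r, HasDerivAt G (g r) r) (hg : Continuous g) :
    IntervalIntegrable (fun y => ρ y * g (absPrimitive c ρ y)) volume c x ∧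
      |∫ y in c..x, ρ y * g (absPrimitive c ρ y)| = |G (absPrimitive c ρ x) - G 0| := by
  rcases le_total c x with hcx | hxc
  · rw [uIoc_of_le hcx] at h0
    have hP : ∀ y ∈ Icc c x, absPrimitive c ρ y = ∫ t in c..y, ρ t := fun y hy =>
      absPrimitive_eq_integral hy.1 fun t ht => h0 t ⟨ht.1, ht.2.trans hy.2⟩
    have hEq : EqOn (fun y => ρ y * g (∫ t in c..y, ρ t))
        (fun y => ρ y * g (absPrimitive c ρ y)) (uIcc c x) := fun y hy => by
      simp only [hP y (uIcc_of_le hcx ▸ hy)]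
    obtain ⟨hint, heq⟩ := integral_mul_comp_primitive hρ hG hg
    exact ⟨hint.congr (hEq.mono uIoc_subset_uIcc),
      by rw [← intervalIntegral.integral_congr hEq, heq, hP x (right_mem_Icc.2 hcx)]⟩
  · rw [uIoc_of_ge hxc] at h0
    have hP : ∀ y ∈ Icc x c, absPrimitive c ρ y = ∫ t in c..y, -ρ t := fun y hy =>
      absPrimitive_eq_integral_neg hy.2 fun t ht => h0 t ⟨hy.1.trans_lt ht.1, ht.2⟩
    have hEq : EqOn (fun y => -(-ρ y * g (∫ t in c..y, -ρ t)))
        (fun y => ρ y * g (absPrimitive c ρ y)) (uIcc c x) := fun y hy => by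
      simp only [hP y (uIcc_of_ge hxc ▸ hy), neg_mul, neg_neg]
    obtain ⟨hint, heq⟩ := integral_mul_comp_primitive hρ.neg hG hg
    exact ⟨hint.neg.congr (hEq.mono uIoc_subset_uIcc),
      by rw [← intervalIntegral.integral_congr hEq, intervalIntegral.integral_neg, abs_neg]
         exact (congrArg abs heq).trans (by rw [hP x (left_mem_Icc.2 hxc)]; rfl)⟩

theorem aestronglyMeasurable_intervalIntegral {F : ℝ → ℝ → ℂ} {S : Set ℝ} {c : ℝ}
    (hS : MeasurableSet S) (hcS : ∀ x ∈ S, uIoc c x ⊆ S)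
    (hF : AEStronglyMeasurable (Function.uncurry F)
      ((volume.restrict S).prod (volume.restrict S))) :
    AEStronglyMeasurable (fun x => ∫ y in c..x, F x y) (volume.restrict S) := by
  have key : ∀ T : Set (ℝ × ℝ), MeasurableSet T →
      (∀ x ∈ S, ∀ y, (x, y) ∈ T → y ∈ S) →
      AEStronglyMeasurable (fun x => ∫ y in {y | (x, y) ∈ T}, F x y) (volume.restrict S) := by
    intro T hT hTS
    refine (hF.indicator hT).integral_prod_right'.congr ?_
    filter_upwards [ae_restrict_mem hS] with x hx
    have hTx : MeasurableSet {y | (x, y) ∈ T} := measurable_prodMk_left hT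
    have hind : (fun y => T.indicator (Function.uncurry F) (x, y)) =
        {y | (x, y) ∈ T}.indicator (F x) := by
      ext y; by_cases hy : (x, y) ∈ T <;> simp [hy, Function.uncurry]
    have hsub : {y | (x, y) ∈ T} ⊆ S := hTS x hx
    rw [hind, setIntegral_indicator hTx, inter_eq_self_of_subset_right hsub]
  refine ((key {p | c < p.2 ∧ p.2 ≤ p.1} ?_ fun x hx y hy => ?_).sub
    (key {p | p.1 < p.2 ∧ p.2 ≤ c} ?_ fun x hx y hy => ?_)).congr
    (Eventually.of_forall fun x => rfl)
  · exact (measurableSet_lt measurable_const measurable_snd).inter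
      (measurableSet_le measurable_snd measurable_fst)
  · exact hcS x hx (Ioc_subset_uIoc hy)
  · exact (measurableSet_lt measurable_fst measurable_snd).inter
      (measurableSet_le measurable_snd measurable_const)
  · exact hcS x hx (Ioc_subset_uIoc' hy)

/-- The Volterra integral operator with kernel `k` and base point `c`. -/
noncomputable def volterraOp (c : ℝ) (k : ℝ → ℝ → ℂ) (u : ℝ → ℂ) (x : ℝ) : ℂ :=
  ∫ y in c..x, k x y * u y

/-- The terms of the Neumann series of `(1 + K)⁻¹ f`, where `K` is the Volterra operator with
kernel `k` and base point `c`. -/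
noncomputable def neumannTerm (c : ℝ) (k : ℝ → ℝ → ℂ) (f : ℝ → ℂ) : ℕ → ℝ → ℂ
  | 0 => f
  | n + 1 => fun x => -volterraOp c k (neumannTerm c k f n) x

/-- The sum of the Neumann series of `(1 + K)⁻¹ f`. -/
noncomputable def neumannSum (c : ℝ) (k : ℝ → ℝ → ℂ) (f : ℝ → ℂ) (x : ℝ) : ℂ :=
  ∑' n, neumannTerm c k f n x

/-- A kernel `k` on `E` which, conjugated by the weight `φ`, is dominated by the integrable
function `ρ` of its second argument; the Volterra operator with base point `c` involves only the
pairs `(x, y)` with `y` between `c` and `x`. -/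
structure VolterraKernel (c : ℝ) (E : Set ℝ) (k : ℝ → ℝ → ℂ) (φ ρ : ℝ → ℝ) : Prop where
  measurableSet : MeasurableSet E
  uIoc_subset : ∀ x ∈ E, uIoc c x ⊆ E
  weight_nonneg : ∀ x ∈ E, 0 ≤ φ x
  majorant_nonneg : ∀ x ∈ E, 0 ≤ ρ x
  aestronglyMeasurable_right : ∀ x ∈ E, AEStronglyMeasurable (k x) (volume.restrict E)
  aestronglyMeasurable :
    AEStronglyMeasurable (Function.uncurry k) ((volume.restrict E).prod (volume.restrict E))
  intervalIntegrable : ∀ x ∈ E, IntervalIntegrable ρ volume c x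
  norm_mul_le : ∀ x ∈ E, ∀ y ∈ uIoc c x, ‖k x y‖ * φ y ≤ φ x * ρ y

theorem hasDerivAt_mul_pow_div_factorial (M : ℝ) (n : ℕ) (r : ℝ) :
    HasDerivAt (fun r => M * (r ^ (n + 1) / (n + 1).factorial)) (M * (r ^ n / n.factorial)) r := by
  convert! ((hasDerivAt_pow (n + 1) r).div_const _).const_mul M using 1
  rw [Nat.factorial_succ]
  push_cast
  field_simp

namespace VolterraKernel

variable {c : ℝ} {E : Set ℝ} {k : ℝ → ℝ → ℂ} {φ ρ : ℝ → ℝ}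

theorem majorant_nonneg_of_mem_uIoc (V : VolterraKernel c E k φ ρ) {x : ℝ} (hx : x ∈ E) :
    ∀ y ∈ uIoc c x, 0 ≤ ρ y := fun y hy => V.majorant_nonneg y (V.uIoc_subset x hx hy)

theorem absPrimitive_le (V : VolterraKernel c E k φ ρ) {x y : ℝ} (hx : x ∈ E)
    (hy : y ∈ uIoc c x) : absPrimitive c ρ y ≤ absPrimitive c ρ x :=
  absPrimitive_mono (V.intervalIntegrable x hx) (V.majorant_nonneg_of_mem_uIoc hx) hy

section

variable {u : ℝ → ℂ} (hu : AEStronglyMeasurable u (volume.restrict E))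
include hu

theorem aestronglyMeasurable_mul (V : VolterraKernel c E k φ ρ) {x : ℝ} (hx : x ∈ E) :
    AEStronglyMeasurable (fun y => k x y * u y) (volume.restrict (uIoc c x)) :=
  ((V.aestronglyMeasurable_right x hx).mul hu).mono_set (V.uIoc_subset x hx)

theorem aestronglyMeasurable_volterraOp (V : VolterraKernel c E k φ ρ) :
    AEStronglyMeasurable (volterraOp c k u) (volume.restrict E) :=
  aestronglyMeasurable_intervalIntegral V.measurableSet V.uIoc_subset
    (V.aestronglyMeasurable.mul hu.comp_snd)

theorem intervalIntegrable_and_norm_volterraOp_le (V : VolterraKernel c E k φ ρ) {g G : ℝ → ℝ}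
    (hG : ∀ r, HasDerivAt G (g r) r) (hg : Continuous g) (hg0 : ∀ r, 0 ≤ r → 0 ≤ g r)
    (hb : ∀ᵐ y ∂(volume.restrict E), ‖u y‖ ≤ φ y * g (absPrimitive c ρ y)) {x : ℝ} (hx : x ∈ E) :
    IntervalIntegrable (fun y => k x y * u y) volume c x ∧
      ‖volterraOp c k u x‖ ≤ φ x * |G (absPrimitive c ρ x) - G 0| := by
  obtain ⟨hint, heq⟩ := integral_mul_comp_absPrimitive (V.intervalIntegrable x hx)
    (V.majorant_nonneg_of_mem_uIoc hx) hG hg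
  have hle : ∀ᵐ y ∂(volume.restrict (uIoc c x)),
      ‖k x y * u y‖ ≤ φ x * (ρ y * g (absPrimitive c ρ y)) := by
    filter_upwards [ae_restrict_of_ae_restrict_of_subset (V.uIoc_subset x hx) hb,
      ae_restrict_mem measurableSet_uIoc] with y hy hyc
    calc ‖k x y * u y‖ ≤ ‖k x y‖ * (φ y * g (absPrimitive c ρ y)) := by
          rw [norm_mul]; gcongr
      _ = ‖k x y‖ * φ y * g (absPrimitive c ρ y) := by ring
      _ ≤ φ x * ρ y * g (absPrimitive c ρ y) :=
          mul_le_mul_of_nonneg_right (V.norm_mul_le x hx y hyc) (hg0 _ (absPrimitive_nonneg _ _ _))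
      _ = φ x * (ρ y * g (absPrimitive c ρ y)) := by ring
  have hint' := hint.const_mul (φ x)
  refine ⟨hint'.mono_fun' (V.aestronglyMeasurable_mul hu hx) hle, ?_⟩
  refine (intervalIntegral.norm_integral_le_abs_of_norm_le hle hint').trans_eq ?_
  rw [intervalIntegral.integral_const_mul, abs_mul, heq, abs_of_nonneg (V.weight_nonneg x hx)]

theorem intervalIntegrable_mul (V : VolterraKernel c E k φ ρ) {M : ℝ} (hM : 0 ≤ M)
    (huM : ∀ᵐ y ∂(volume.restrict E), ‖u y‖ ≤ φ y * M) {x : ℝ} (hx : x ∈ E) :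
    IntervalIntegrable (fun y => k x y * u y) volume c x :=
  (V.intervalIntegrable_and_norm_volterraOp_le hu (fun r => (hasDerivAt_id r).const_mul M)
    continuous_const (fun _ _ => by simpa using hM) (by simpa using huM) hx).1

theorem norm_volterraOp_le (V : VolterraKernel c E k φ ρ) {M : ℝ} (hM : 0 ≤ M)
    (huM : ∀ᵐ y ∂(volume.restrict E), ‖u y‖ ≤ φ y * M) {x : ℝ} (hx : x ∈ E) :
    ‖volterraOp c k u x‖ ≤ φ x * (M * absPrimitive c ρ x) := by
  have h := (V.intervalIntegrable_and_norm_volterraOp_le hu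
    (fun r => (hasDerivAt_id r).const_mul M) continuous_const (fun _ _ => by simpa using hM)
    (by simpa using huM) hx).2
  rwa [id, id, mul_zero, sub_zero, abs_of_nonneg (mul_nonneg hM (absPrimitive_nonneg _ _ _))] at h

end

section NeumannSeries

variable {f : ℝ → ℂ} (hf : AEStronglyMeasurable f (volume.restrict E))
include hf

theorem aestronglyMeasurable_neumannTerm (V : VolterraKernel c E k φ ρ) :
    ∀ n, AEStronglyMeasurable (neumannTerm c k f n) (volume.restrict E)
  | 0 => hf
  | n + 1 => (V.aestronglyMeasurable_volterraOp (V.aestronglyMeasurable_neumannTerm n)).neg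

variable {M : ℝ} (hM : 0 ≤ M) (hfM : ∀ᵐ y ∂(volume.restrict E), ‖f y‖ ≤ φ y * M)
include hM hfM

theorem norm_neumannTerm_succ_le (V : VolterraKernel c E k φ ρ) (n : ℕ) :
    ∀ x ∈ E, ‖neumannTerm c k f (n + 1) x‖ ≤
      φ x * (M * (absPrimitive c ρ x ^ (n + 1) / (n + 1).factorial)) := by
  have step : ∀ n, (∀ᵐ y ∂(volume.restrict E), ‖neumannTerm c k f n y‖ ≤
      φ y * (M * (absPrimitive c ρ y ^ n / n.factorial))) → ∀ x ∈ E,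
      ‖neumannTerm c k f (n + 1) x‖ ≤
        φ x * (M * (absPrimitive c ρ x ^ (n + 1) / (n + 1).factorial)) := fun n hn x hx => by
    have h := (V.intervalIntegrable_and_norm_volterraOp_le (V.aestronglyMeasurable_neumannTerm hf n)
      (hasDerivAt_mul_pow_div_factorial M n) (by fun_prop) (fun r hr => by positivity) hn hx).2
    have := absPrimitive_nonneg c ρ x
    rwa [zero_pow n.succ_ne_zero, zero_div, mul_zero, sub_zero, abs_of_nonneg (by positivity),
      ← norm_neg] at h
  induction n with
  | zero => exact step 0 (by simpa [neumannTerm] using hfM)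
  | succ n ih => exact step (n + 1) (ae_restrict_of_forall_mem V.measurableSet ih)

theorem norm_neumannTerm_le (V : VolterraKernel c E k φ ρ) {x : ℝ} (hx : x ∈ E)
    (hfx : ‖f x‖ ≤ φ x * M) (n : ℕ) :
    ‖neumannTerm c k f n x‖ ≤ φ x * (M * (absPrimitive c ρ x ^ n / n.factorial)) := by
  cases n with
  | zero => simpa [neumannTerm] using hfx
  | succ n => exact V.norm_neumannTerm_succ_le hf hM hfM n x hx

theorem summable_neumannTerm (V : VolterraKernel c E k φ ρ) {x : ℝ} (hx : x ∈ E) :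
    Summable fun n => neumannTerm c k f n x := by
  refine (summable_nat_add_iff 1).1 (Summable.of_norm_bounded ?_
    fun n => V.norm_neumannTerm_succ_le hf hM hfM n x hx)
  exact (summable_nat_add_iff 1).2
    (((Real.summable_pow_div_factorial (absPrimitive c ρ x)).mul_left M).mul_left (φ x))

theorem norm_neumannSum_le (V : VolterraKernel c E k φ ρ) {x : ℝ} (hx : x ∈ E)
    (hfx : ‖f x‖ ≤ φ x * M) :
    ‖neumannSum c k f x‖ ≤ φ x * (M * Real.exp (absPrimitive c ρ x)) := by
  refine tsum_of_norm_bounded ?_ (V.norm_neumannTerm_le hf hM hfM hx hfx)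
  rw [Real.exp_eq_exp_ℝ]
  exact ((NormedSpace.expSeries_div_hasSum_exp (absPrimitive c ρ x)).mul_left M).mul_left (φ x)

theorem aestronglyMeasurable_neumannSum (V : VolterraKernel c E k φ ρ) :
    AEStronglyMeasurable (neumannSum c k f) (volume.restrict E) := by
  refine aestronglyMeasurable_of_tendsto_ae atTop
    (fun n => (Finset.range n).aestronglyMeasurable_fun_sum
      fun i _ => V.aestronglyMeasurable_neumannTerm hf i) ?_
  filter_upwards [ae_restrict_mem V.measurableSet] with x hx
  exact (V.summable_neumannTerm hf hM hfM hx).hasSum.tendsto_sum_nat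

theorem hasSum_volterraOp_neumannTerm (V : VolterraKernel c E k φ ρ) {x : ℝ} (hx : x ∈ E) :
    HasSum (fun n => volterraOp c k (neumannTerm c k f n) x)
      (volterraOp c k (neumannSum c k f) x) := by
  have hsum := (Real.summable_pow_div_factorial (absPrimitive c ρ x)).mul_left M
  refine intervalIntegral.hasSum_integral_of_dominated_convergence
    (fun n y => φ x * ρ y * (M * (absPrimitive c ρ x ^ n / n.factorial)))
    (fun n => V.aestronglyMeasurable_mul (V.aestronglyMeasurable_neumannTerm hf n) hx)
    (fun n => ?_) (Eventually.of_forall fun y _ => hsum.mul_left _) ?_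
    (Eventually.of_forall fun y hy =>
      (V.summable_neumannTerm hf hM hfM (V.uIoc_subset x hx hy)).hasSum.mul_left _)
  · rw [← ae_restrict_iff' measurableSet_uIoc]
    filter_upwards [ae_restrict_of_ae_restrict_of_subset (V.uIoc_subset x hx) hfM,
      ae_restrict_mem measurableSet_uIoc] with y hfy hy
    have hR := absPrimitive_nonneg c ρ y
    calc ‖k x y * neumannTerm c k f n y‖
        ≤ ‖k x y‖ * (φ y * (M * (absPrimitive c ρ y ^ n / n.factorial))) := by
          rw [norm_mul]
          gcongr
          exact V.norm_neumannTerm_le hf hM hfM (V.uIoc_subset x hx hy) hfy n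
      _ = ‖k x y‖ * φ y * (M * (absPrimitive c ρ y ^ n / n.factorial)) := by ring
      _ ≤ φ x * ρ y * (M * (absPrimitive c ρ x ^ n / n.factorial)) := by
          have := V.norm_mul_le x hx y hy
          have := V.absPrimitive_le hx hy
          have := mul_nonneg (V.weight_nonneg x hx) (V.majorant_nonneg_of_mem_uIoc hx y hy)
          gcongr
  · simp only [tsum_mul_left]
    exact ((V.intervalIntegrable x hx).const_mul _).mul_const _

theorem neumannSum_add_volterraOp (V : VolterraKernel c E k φ ρ) {x : ℝ} (hx : x ∈ E) :
    neumannSum c k f x + volterraOp c k (neumannSum c k f) x = f x := by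
  rw [neumannSum, (V.summable_neumannTerm hf hM hfM hx).tsum_eq_zero_add,
    ← (V.hasSum_volterraOp_neumannTerm hf hM hfM hx).tsum_eq]
  simp only [neumannTerm, tsum_neg, neg_add_cancel_right]

end NeumannSeries

section BoundedInverse

variable {h : ℝ → ℂ} {A B : ℝ} (hh : AEStronglyMeasurable h (volume.restrict E))
  (hA : 0 ≤ A) (hB : 0 ≤ B)
include hh hA hB

theorem norm_le_exp_add_pow_succ (V : VolterraKernel c E k φ ρ) {n : ℕ}
    (hn : ∀ᵐ y ∂(volume.restrict E), ‖h y‖ ≤ φ y *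
      (B * Real.exp (absPrimitive c ρ y) + A * (absPrimitive c ρ y ^ n / n.factorial)))
    {x : ℝ} (hx : x ∈ E) (hxB : ‖h x + volterraOp c k h x‖ ≤ φ x * B) :
    ‖h x‖ ≤ φ x * (B * Real.exp (absPrimitive c ρ x) +
      A * (absPrimitive c ρ x ^ (n + 1) / (n + 1).factorial)) := by
  have hR := absPrimitive_nonneg c ρ x
  have hK := (V.intervalIntegrable_and_norm_volterraOp_le hh
    (fun r => ((Real.hasDerivAt_exp r).const_mul B).add (hasDerivAt_mul_pow_div_factorial A n r))
    (by fun_prop) (fun r hr => by positivity) hn hx).2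
  have hexp : 0 ≤ B * Real.exp (absPrimitive c ρ x) - B := by
    nlinarith [Real.one_le_exp hR]
  have hpow : 0 ≤ A * (absPrimitive c ρ x ^ (n + 1) / (n + 1).factorial) := by positivity
  simp only [Pi.add_apply, Real.exp_zero, mul_one, zero_pow n.succ_ne_zero, zero_div,
    mul_zero, add_zero] at hK
  rw [abs_of_nonneg (by linarith)] at hK
  calc ‖h x‖ = ‖(h x + volterraOp c k h x) - volterraOp c k h x‖ := by rw [add_sub_cancel_right]
    _ ≤ φ x * B + _ := (norm_sub_le _ _).trans (add_le_add hxB hK)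
    _ = _ := by ring

theorem norm_le_of_norm_add_volterraOp_le (V : VolterraKernel c E k φ ρ)
    (hhA : ∀ᵐ y ∂(volume.restrict E), ‖h y‖ ≤ φ y * A)
    (hhB : ∀ᵐ y ∂(volume.restrict E), ‖h y + volterraOp c k h y‖ ≤ φ y * B) {x : ℝ} (hx : x ∈ E)
    (hxB : ‖h x + volterraOp c k h x‖ ≤ φ x * B) :
    ‖h x‖ ≤ φ x * (B * Real.exp (absPrimitive c ρ x)) := by
  have hae : ∀ n : ℕ, ∀ᵐ y ∂(volume.restrict E), ‖h y‖ ≤ φ y *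
      (B * Real.exp (absPrimitive c ρ y) + A * (absPrimitive c ρ y ^ n / n.factorial)) := by
    intro n
    induction n with
    | zero =>
      filter_upwards [hhA, ae_restrict_mem V.measurableSet] with y hy hyE
      refine hy.trans (mul_le_mul_of_nonneg_left ?_ (V.weight_nonneg y hyE))
      simpa using mul_nonneg hB (Real.exp_pos _).le
    | succ n ih =>
      filter_upwards [hhB, ae_restrict_mem V.measurableSet] with y hy hyE
      exact V.norm_le_exp_add_pow_succ hh hA hB ih hyE hy
  have hlim := (tendsto_add_atTop_iff_nat 1).2
    (FloorSemiring.tendsto_pow_div_factorial_atTop (absPrimitive c ρ x))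
  have hlim' := ((hlim.const_mul A).const_add (B * Real.exp (absPrimitive c ρ x))).const_mul (φ x)
  rw [mul_zero, add_zero] at hlim'
  exact ge_of_tendsto' hlim' fun n => V.norm_le_exp_add_pow_succ hh hA hB (hae n) hx hxB

end BoundedInverse

end VolterraKernel

/-- `f ∈ AC¹]0,∞[` and `f'' = v f` almost everywhere. -/
structure SolvesODE (v : ℝ → ℂ) (f : ℝ → ℂ) : Prop where
  differentiableAt : ∀ x, 0 < x → DifferentiableAt ℝ f x
  isAC_deriv : IsAC (deriv f)
  eq : ∀ᵐ x ∂(volume.restrict (Ioi (0 : ℝ))), HasDerivAt (deriv f) (v x * f x) x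

/-- The function `v` for which `L_{m²} f = -k² f` reads `f'' = v f`. -/
noncomputable def besselPotential (m k : ℂ) (Q : ℝ → ℂ) (x : ℝ) : ℂ :=
  (m ^ 2 - 1 / 4) * (1 / (x : ℂ) ^ 2) + k ^ 2 + Q x

theorem isSolution_iff_solvesODE {m k : ℂ} {Q f : ℝ → ℂ} :
    IsSolution m k Q f ↔ SolvesODE (besselPotential m k Q) f := by
  constructor
  · rintro ⟨⟨h1, h2⟩, h3⟩
    refine ⟨h1, h2, ?_⟩
    filter_upwards [h3, h2.ae_differentiableAt] with x hx hd
    convert! hd.hasDerivAt using 1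
    rw [besselExpr] at hx
    rw [besselPotential]
    linear_combination hx
  · rintro ⟨h1, h2, h3⟩
    refine ⟨⟨h1, h2⟩, ?_⟩
    filter_upwards [h3] with x hx
    rw [besselExpr, hx.deriv, besselPotential]
    ring

theorem solvesODE_of_hasDerivAt {v f f' : ℝ → ℂ} (h : ∀ x, 0 < x → HasDerivAt f (f' x) x)
    (hf' : IsAC f') (he : ∀ᵐ x ∂(volume.restrict (Ioi (0 : ℝ))), HasDerivAt f' (v x * f x) x) :
    SolvesODE v f := by
  have hd : EqOn f' (deriv f) (Ioi 0) := fun x hx => (h x hx).deriv.symm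
  refine ⟨fun x hx => (h x hx).differentiableAt, hf'.congr hd, ?_⟩
  filter_upwards [he, ae_restrict_mem measurableSet_Ioi] with x hx hx0
  exact hx.congr_of_eventuallyEq (hd.symm.eventuallyEq_of_mem (Ioi_mem_nhds hx0))

namespace SolvesODE

variable {v f g : ℝ → ℂ}

theorem hasDerivAt (hf : SolvesODE v f) {x : ℝ} (hx : 0 < x) : HasDerivAt f (deriv f x) x :=
  (hf.differentiableAt x hx).hasDerivAt

theorem isAC (hf : SolvesODE v f) : IsAC f :=
  isAC_of_hasDerivAt (fun _ hx => hf.hasDerivAt hx) hf.isAC_deriv.continuousOn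

theorem continuousOn (hf : SolvesODE v f) : ContinuousOn f (Ioi 0) := hf.isAC.continuousOn

theorem linear_combination (hf : SolvesODE v f) (hg : SolvesODE v g) (a b : ℂ) :
    SolvesODE v (fun x => a * f x + b * g x) := by
  refine solvesODE_of_hasDerivAt (f' := fun x => a * deriv f x + b * deriv g x)
    (fun x hx => ((hf.hasDerivAt hx).const_mul a).add ((hg.hasDerivAt hx).const_mul b))
    ((hf.isAC_deriv.const_mul a).add (hg.isAC_deriv.const_mul b)) ?_
  filter_upwards [hf.eq, hg.eq] with x h1 h2
  convert! (h1.const_mul a).add (h2.const_mul b) using 1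
  ring

theorem sub (hf : SolvesODE v f) (hg : SolvesODE v g) : SolvesODE v (fun x => f x - g x) := by
  simpa [sub_eq_add_neg] using hf.linear_combination hg 1 (-1)

theorem isAC_wronskian (hf : SolvesODE v f) (hg : SolvesODE v g) : IsAC (wronskian f g) :=
  (hf.isAC.mul hg.isAC_deriv).sub (hf.isAC_deriv.mul hg.isAC)

theorem hasDerivAt_wronskian (hf : SolvesODE v f) (hg : SolvesODE v g) :
    ∀ᵐ x ∂(volume.restrict (Ioi (0 : ℝ))), HasDerivAt (wronskian f g) 0 x := by
  filter_upwards [hf.eq, hg.eq, ae_restrict_mem measurableSet_Ioi] with x h1 h2 hx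
  have := ((hf.hasDerivAt hx).mul h2).sub (h1.mul (hg.hasDerivAt hx))
  convert! this using 1
  ring

theorem wronskian_eq (hf : SolvesODE v f) (hg : SolvesODE v g) {a b : ℝ} (ha : 0 < a)
    (hb : 0 < b) : wronskian f g b = wronskian f g a := by
  have := (hf.isAC_wronskian hg).sub_eq_integral (hf.hasDerivAt_wronskian hg) ha hb
    intervalIntegrable_const
  simpa [sub_eq_zero] using this

end SolvesODE

/-- A fundamental system `h = (h₁, h₂)` of solutions of `f'' = v f`. -/
structure FundamentalSystem (v : ℝ → ℂ) (h : (ℝ → ℂ) × (ℝ → ℂ)) : Prop where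
  fst : SolvesODE v h.1
  snd : SolvesODE v h.2
  wronskian_ne_zero : wronskian h.1 h.2 1 ≠ 0

/-- The bisolution `(h₁(x) h₂(y) - h₂(x) h₁(y)) / W(h₁, h₂)` of `f'' = v f` built from a fundamental
system `h`; `canonicalBisolution` is the case `h = fundamentalPair m k`. -/
noncomputable def bisolution (h : (ℝ → ℂ) × (ℝ → ℂ)) (x y : ℝ) : ℂ :=
  (h.1 x * h.2 y - h.2 x * h.1 y) / wronskian h.1 h.2 1

/-- The derivative of `bisolution h x y` with respect to `x`. -/
noncomputable def bisolutionDeriv (h : (ℝ → ℂ) × (ℝ → ℂ)) (x y : ℝ) : ℂ :=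
  (deriv h.1 x * h.2 y - deriv h.2 x * h.1 y) / wronskian h.1 h.2 1

namespace FundamentalSystem

section VariationOfConstants

variable {v q : ℝ → ℂ} {h : (ℝ → ℂ) × (ℝ → ℂ)} {c : ℝ}
  (i₁ : ∀ x, 0 < x → IntervalIntegrable (fun y => h.1 y * q y) volume c x)
  (i₂ : ∀ x, 0 < x → IntervalIntegrable (fun y => h.2 y * q y) volume c x)

theorem integral_combination_mul {a b w : ℂ} {x : ℝ}
    (j₁ : IntervalIntegrable (fun y => h.1 y * q y) volume c x)
    (j₂ : IntervalIntegrable (fun y => h.2 y * q y) volume c x) :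
    ∫ y in c..x, (a * h.2 y - b * h.1 y) / w * q y =
      w⁻¹ * (a * (∫ y in c..x, h.2 y * q y) - b * ∫ y in c..x, h.1 y * q y) := by
  rw [← intervalIntegral.integral_const_mul, ← intervalIntegral.integral_const_mul,
    ← intervalIntegral.integral_sub (j₂.const_mul a) (j₁.const_mul b),
    ← intervalIntegral.integral_const_mul]
  congr 1 with y
  ring

include i₁ i₂

theorem volterraOp_bisolution {x : ℝ} (hx : 0 < x) :
    volterraOp c (bisolution h) q x = (wronskian h.1 h.2 1)⁻¹ *
      (h.1 x * (∫ y in c..x, h.2 y * q y) - h.2 x * ∫ y in c..x, h.1 y * q y) :=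
  integral_combination_mul (i₁ x hx) (i₂ x hx)

theorem volterraOp_bisolutionDeriv {x : ℝ} (hx : 0 < x) :
    volterraOp c (bisolutionDeriv h) q x = (wronskian h.1 h.2 1)⁻¹ *
      (deriv h.1 x * (∫ y in c..x, h.2 y * q y) - deriv h.2 x * ∫ y in c..x, h.1 y * q y) :=
  integral_combination_mul (i₁ x hx) (i₂ x hx)

theorem isAC_volterraOp_bisolutionDeriv (F : FundamentalSystem v h) :
    IsAC (volterraOp c (bisolutionDeriv h) q) :=
  (((F.fst.isAC_deriv.mul (isAC_integral i₂)).sub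
    (F.snd.isAC_deriv.mul (isAC_integral i₁))).const_mul _).congr
      fun _ hx => (volterraOp_bisolutionDeriv i₁ i₂ hx).symm

theorem hasDerivAt_volterraOp_bisolution (F : FundamentalSystem v h) {x : ℝ} (hx : 0 < x) :
    HasDerivAt (volterraOp c (bisolution h) q) (volterraOp c (bisolutionDeriv h) q x) x := by
  have hac : IsAC (volterraOp c (bisolution h) q) :=
    (((F.fst.isAC.mul (isAC_integral i₂)).sub (F.snd.isAC.mul (isAC_integral i₁))).const_mul
      _).congr fun _ hx => (volterraOp_bisolution i₁ i₂ hx).symm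
  refine hac.hasDerivAt_of_continuousOn ?_
    (F.isAC_volterraOp_bisolutionDeriv i₁ i₂).continuousOn hx
  filter_upwards [ae_hasDerivAt_integral i₁, ae_hasDerivAt_integral i₂,
    ae_restrict_mem measurableSet_Ioi] with x e₁ e₂ hx
  have := (((F.fst.hasDerivAt hx).mul e₂).sub ((F.snd.hasDerivAt hx).mul e₁)).const_mul
    (wronskian h.1 h.2 1)⁻¹
  refine HasDerivAt.congr_of_eventuallyEq ?_
    (EqOn.eventuallyEq_of_mem (fun _ hy => volterraOp_bisolution i₁ i₂ hy) (Ioi_mem_nhds hx))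
  convert! this using 1
  rw [volterraOp_bisolutionDeriv i₁ i₂ hx]
  ring

theorem hasDerivAt_volterraOp_bisolutionDeriv (F : FundamentalSystem v h) :
    ∀ᵐ x ∂(volume.restrict (Ioi (0 : ℝ))), HasDerivAt (volterraOp c (bisolutionDeriv h) q)
      (v x * volterraOp c (bisolution h) q x - q x) x := by
  filter_upwards [ae_hasDerivAt_integral i₁, ae_hasDerivAt_integral i₂,
    ae_restrict_mem measurableSet_Ioi, F.fst.eq, F.snd.eq] with x e₁ e₂ hx d₁ d₂
  have := ((d₁.mul e₂).sub (d₂.mul e₁)).const_mul (wronskian h.1 h.2 1)⁻¹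
  refine HasDerivAt.congr_of_eventuallyEq ?_
    (EqOn.eventuallyEq_of_mem (fun _ hy => volterraOp_bisolutionDeriv i₁ i₂ hy) (Ioi_mem_nhds hx))
  convert! this using 1
  have hW := F.fst.wronskian_eq F.snd one_pos hx
  have hW0 := F.wronskian_ne_zero
  rw [volterraOp_bisolution i₁ i₂ hx]
  rw [wronskian] at hW
  field_simp
  linear_combination q x * hW

end VariationOfConstants

section Perturbation

variable {v Q g : ℝ → ℂ} {h : (ℝ → ℂ) × (ℝ → ℂ)} {c : ℝ} (F : FundamentalSystem v h)
  (i₁ : ∀ x, 0 < x → IntervalIntegrable (fun y => h.1 y * (Q y * g y)) volume c x)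
  (i₂ : ∀ x, 0 < x → IntervalIntegrable (fun y => h.2 y * (Q y * g y)) volume c x)
include F i₁ i₂

theorem hasDerivAt_of_add_volterraOp_eq {g₀ : ℝ → ℂ} (hg₀ : SolvesODE v g₀)
    (hg : ∀ x, 0 < x → g x + volterraOp c (bisolution h) (fun y => Q y * g y) x = g₀ x)
    {x : ℝ} (hx : 0 < x) : HasDerivAt g
      (deriv g₀ x - volterraOp c (bisolutionDeriv h) (fun y => Q y * g y) x) x :=
  ((hg₀.hasDerivAt hx).sub (F.hasDerivAt_volterraOp_bisolution i₁ i₂ hx)).congr_of_eventuallyEq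
    (EqOn.eventuallyEq_of_mem (fun y hy => eq_sub_of_add_eq (hg y hy)) (Ioi_mem_nhds hx))

theorem solvesODE_of_add_volterraOp_eq {g₀ : ℝ → ℂ} (hg₀ : SolvesODE v g₀)
    (hg : ∀ x, 0 < x → g x + volterraOp c (bisolution h) (fun y => Q y * g y) x = g₀ x) :
    SolvesODE (fun x => v x + Q x) g := by
  refine solvesODE_of_hasDerivAt (fun x hx => F.hasDerivAt_of_add_volterraOp_eq i₁ i₂ hg₀ hg hx)
    (hg₀.isAC_deriv.sub (F.isAC_volterraOp_bisolutionDeriv i₁ i₂)) ?_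
  filter_upwards [hg₀.eq, F.hasDerivAt_volterraOp_bisolutionDeriv i₁ i₂,
    ae_restrict_mem measurableSet_Ioi] with x h₁ h₂ hx
  convert! h₁.sub h₂ using 1
  linear_combination v x * hg x hx

theorem hasDerivAt_add_volterraOp (hg : SolvesODE (fun x => v x + Q x) g) {x : ℝ} (hx : 0 < x) :
    HasDerivAt (fun x => g x + volterraOp c (bisolution h) (fun y => Q y * g y) x)
      (deriv g x + volterraOp c (bisolutionDeriv h) (fun y => Q y * g y) x) x :=
  (hg.hasDerivAt hx).add (F.hasDerivAt_volterraOp_bisolution i₁ i₂ hx)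

theorem solvesODE_add_volterraOp (hg : SolvesODE (fun x => v x + Q x) g) :
    SolvesODE v (fun x => g x + volterraOp c (bisolution h) (fun y => Q y * g y) x) := by
  refine solvesODE_of_hasDerivAt (fun x hx => F.hasDerivAt_add_volterraOp i₁ i₂ hg hx)
    (hg.isAC_deriv.add (F.isAC_volterraOp_bisolutionDeriv i₁ i₂)) ?_
  filter_upwards [hg.eq, F.hasDerivAt_volterraOp_bisolutionDeriv i₁ i₂] with x h₁ h₂
  convert! h₁.add h₂ using 1
  ring

end Perturbation

end FundamentalSystem

section Picard

theorem solvesODE_affine (a b : ℂ) : SolvesODE 0 (fun x => a * x + b) := by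
  have hderiv : ∀ x : ℝ, HasDerivAt (fun x : ℝ => a * (x : ℂ) + b) a x := fun x => by
    simpa using (((hasDerivAt_id x).ofReal_comp).const_mul a).add_const b
  refine solvesODE_of_hasDerivAt (f' := fun _ => a) (fun x _ => hderiv x)
    (isAC_of_hasDerivAt (fun x _ => hasDerivAt_const x a) continuousOn_const)
    (Eventually.of_forall fun x => ?_)
  simpa using hasDerivAt_const x a

/-- The fundamental system `(x, 1)` of `f'' = 0`. -/
noncomputable def affinePair : (ℝ → ℂ) × (ℝ → ℂ) := (fun x => x, fun _ => 1)

theorem wronskian_affinePair : wronskian affinePair.1 affinePair.2 1 = -1 := by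
  have : HasDerivAt (fun x : ℝ => (x : ℂ)) 1 1 := by
    simpa using (hasDerivAt_id (1 : ℝ)).ofReal_comp
  simp [wronskian, affinePair, this.deriv]

theorem fundamentalSystem_affinePair : FundamentalSystem 0 affinePair where
  fst := by simpa [affinePair] using solvesODE_affine 1 0
  snd := by simpa [affinePair] using solvesODE_affine 0 1
  wronskian_ne_zero := by simp [wronskian_affinePair]

theorem bisolution_affinePair (x y : ℝ) : bisolution affinePair x y = (y - x : ℝ) := by
  rw [bisolution, wronskian_affinePair]
  simp only [affinePair]
  push_cast
  ring

variable {v : ℝ → ℂ} (hv : ContinuousOn v (Ioi 0))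
include hv

theorem volterraKernel_bisolution_affinePair :
    VolterraKernel 1 (Ioi 0) (fun x y => bisolution affinePair x y * v y) (max 1)
      (fun y => max 1 y * ‖v y‖) where
  measurableSet := measurableSet_Ioi
  uIoc_subset x hx := uIoc_subset_uIcc.trans (uIcc_subset_Ioi_zero one_pos hx)
  weight_nonneg x _ := by positivity
  majorant_nonneg x _ := by positivity
  aestronglyMeasurable_right x _ := by
    simp only [bisolution_affinePair]
    exact (ContinuousOn.mul (by fun_prop) hv).aestronglyMeasurable measurableSet_Ioi
  aestronglyMeasurable := by
    simp only [bisolution_affinePair]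
    exact (Continuous.aestronglyMeasurable (by fun_prop)).mul
      (hv.aestronglyMeasurable measurableSet_Ioi).comp_snd
  intervalIntegrable x hx := (ContinuousOn.mul (by fun_prop)
    (hv.mono (uIcc_subset_Ioi_zero one_pos hx)).norm).intervalIntegrable
  norm_mul_le x (hx : 0 < x) y hy := by
    have hxy : |y - x| ≤ max 1 x := by
      rcases mem_uIoc.1 hy with hy | hy <;> rw [abs_le] <;>
        constructor <;> linarith [hy.1, hy.2, le_max_left 1 x, le_max_right 1 x]
    rw [bisolution_affinePair, norm_mul, Complex.norm_real, Real.norm_eq_abs, mul_assoc,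
      mul_comm ‖v y‖]
    gcongr

theorem exists_add_volterraOp_affinePair_eq {g₀ : ℝ → ℂ} {M : ℝ} (hM : 0 ≤ M)
    (hg₀ : ContinuousOn g₀ (Ioi 0)) (hbound : ∀ x ∈ Ioi (0 : ℝ), ‖g₀ x‖ ≤ max 1 x * M) :
    ∃ f : ℝ → ℂ, (∀ x, 0 < x → IntervalIntegrable f volume 1 x) ∧
      ∀ x, 0 < x → f x + volterraOp 1 (bisolution affinePair) (fun y => v y * f y) x = g₀ x := by
  have V := volterraKernel_bisolution_affinePair hv
  have hmeas := hg₀.aestronglyMeasurable measurableSet_Ioi (μ := volume)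
  have hae : ∀ᵐ x ∂(volume.restrict (Ioi 0)), ‖g₀ x‖ ≤ max 1 x * M :=
    ae_restrict_of_forall_mem measurableSet_Ioi hbound
  refine ⟨neumannSum 1 (fun x y => bisolution affinePair x y * v y) g₀, fun x hx => ?_,
    fun x hx => ?_⟩
  · refine IntervalIntegrable.mono_fun' (g := fun y => max 1 y *
        (M * Real.exp (absPrimitive 1 (fun y => max 1 y * ‖v y‖) x)))
      (Continuous.intervalIntegrable (by fun_prop) _ _)
      ((V.aestronglyMeasurable_neumannSum hmeas hM hae).mono_set (V.uIoc_subset x hx)) ?_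
    filter_upwards [ae_restrict_mem measurableSet_uIoc] with y hy
    have hy0 := V.uIoc_subset x hx hy
    refine (V.norm_neumannSum_le hmeas hM hae hy0 (hbound y hy0)).trans ?_
    have := V.absPrimitive_le hx hy
    gcongr
  · simpa only [volterraOp, mul_assoc] using V.neumannSum_add_volterraOp hmeas hM hae hx

theorem exists_solvesODE (α β : ℂ) : ∃ f, SolvesODE v f ∧ f 1 = α ∧ deriv f 1 = β := by
  have hg₀ : SolvesODE 0 (fun x => β * x + (α - β)) := solvesODE_affine β (α - β)
  have hbound : ∀ x ∈ Ioi (0 : ℝ), ‖β * (x : ℂ) + (α - β)‖ ≤ max 1 x * (‖α‖ + ‖β‖) := by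
    intro x (hx : 0 < x)
    have hx1 : ‖(x : ℂ) - 1‖ ≤ max 1 x := by
      rw [← Complex.ofReal_one, ← Complex.ofReal_sub, Complex.norm_real, Real.norm_eq_abs, abs_le]
      constructor <;> linarith [le_max_left 1 x, le_max_right 1 x]
    calc ‖β * (x : ℂ) + (α - β)‖ = ‖α + β * (x - 1)‖ := by ring_nf
      _ ≤ ‖α‖ + ‖β‖ * max 1 x := (norm_add_le _ _).trans (by rw [norm_mul]; gcongr)
      _ ≤ max 1 x * (‖α‖ + ‖β‖) := by nlinarith [norm_nonneg α, le_max_left 1 x]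
  obtain ⟨f, hint, hf⟩ := exists_add_volterraOp_affinePair_eq hv (by positivity)
    hg₀.continuousOn hbound
  have i : ∀ w : ℝ → ℂ, Continuous w → ∀ x, 0 < x →
      IntervalIntegrable (fun y => w y * (v y * f y)) volume 1 x := fun w hw x hx => by
    simpa only [Pi.mul_apply, mul_assoc] using (hint x hx).continuousOn_mul
      (hw.continuousOn.mul (hv.mono (uIcc_subset_Ioi_zero one_pos hx)))
  have F := fundamentalSystem_affinePair
  have i₁ := i affinePair.1 Complex.continuous_ofReal
  have i₂ := i affinePair.2 continuous_const
  refine ⟨f, by simpa using F.solvesODE_of_add_volterraOp_eq i₁ i₂ hg₀ hf, ?_, ?_⟩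
  · simpa [volterraOp] using hf 1 one_pos
  · have hderiv : deriv (fun x : ℝ => β * (x : ℂ) + (α - β)) 1 = β := by
      simpa using ((((hasDerivAt_id (1 : ℝ)).ofReal_comp).const_mul β).add_const (α - β)).deriv
    rw [(F.hasDerivAt_of_add_volterraOp_eq i₁ i₂ hg₀ hf one_pos).deriv, hderiv, volterraOp,
      intervalIntegral.integral_same, sub_zero]

theorem exists_fundamentalSystem : ∃ h, FundamentalSystem v h := by
  obtain ⟨f, hf, hf1, hf1'⟩ := exists_solvesODE hv 1 0
  obtain ⟨g, hg, hg1, hg1'⟩ := exists_solvesODE hv 0 1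
  exact ⟨(f, g), hf, hg, by simp [wronskian, hf1, hf1', hg1, hg1']⟩

end Picard

theorem isFundamentalPair_iff {m k : ℂ} {h : (ℝ → ℂ) × (ℝ → ℂ)} :
    IsFundamentalPair m k h ↔ FundamentalSystem (besselPotential m k 0) h :=
  ⟨fun ⟨h₁, h₂, hw⟩ => ⟨isSolution_iff_solvesODE.1 h₁, isSolution_iff_solvesODE.1 h₂, hw⟩,
    fun ⟨h₁, h₂, hw⟩ => ⟨isSolution_iff_solvesODE.2 h₁, isSolution_iff_solvesODE.2 h₂, hw⟩⟩

theorem continuousOn_besselPotential (m k : ℂ) : ContinuousOn (besselPotential m k 0) (Ioi 0) := by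
  have hx : ∀ x ∈ Ioi (0 : ℝ), (x : ℂ) ^ 2 ≠ 0 := fun x (hx : 0 < x) => by
    simpa using hx.ne'
  unfold besselPotential
  fun_prop (disch := assumption)

theorem fundamentalSystem_fundamentalPair (m k : ℂ) :
    FundamentalSystem (besselPotential m k 0) (fundamentalPair m k) := by
  obtain ⟨h, hh⟩ := exists_fundamentalSystem (continuousOn_besselPotential m k)
  exact isFundamentalPair_iff.1 (Classical.epsilon_spec ⟨h, isFundamentalPair_iff.2 hh⟩)

/-! ### Fundamental systems with a controlled bisolution -/

namespace FundamentalSystem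

variable {v : ℝ → ℂ} {h : (ℝ → ℂ) × (ℝ → ℂ)}

theorem continuousOn_bisolution (F : FundamentalSystem v h) :
    ContinuousOn (Function.uncurry (bisolution h)) (Ioi 0 ×ˢ Ioi 0) := by
  have h₁ := F.fst.continuousOn
  have h₂ := F.snd.continuousOn
  have hx : MapsTo Prod.fst (Ioi (0 : ℝ) ×ˢ Ioi (0 : ℝ)) (Ioi 0) := fun _ hp => hp.1
  have hy : MapsTo Prod.snd (Ioi (0 : ℝ) ×ˢ Ioi (0 : ℝ)) (Ioi 0) := fun _ hp => hp.2
  exact (((h₁.comp continuousOn_fst hx).mul (h₂.comp continuousOn_snd hy)).sub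
    ((h₂.comp continuousOn_fst hx).mul (h₁.comp continuousOn_snd hy))).div_const _

section Measurability

variable {Q : ℝ → ℂ} {E : Set ℝ} (hE : MeasurableSet E) (hE0 : E ⊆ Ioi 0)
  (hQ : AEStronglyMeasurable Q (volume.restrict E))
include hE hE0 hQ

theorem aestronglyMeasurable_bisolution_mul (F : FundamentalSystem v h) :
    AEStronglyMeasurable (Function.uncurry fun x y => bisolution h x y * Q y)
      ((volume.restrict E).prod (volume.restrict E)) := by
  refine AEStronglyMeasurable.mul ?_ hQ.comp_snd
  rw [Measure.prod_restrict]
  exact (F.continuousOn_bisolution.mono (prod_mono hE0 hE0)).aestronglyMeasurable (hE.prod hE)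

theorem aestronglyMeasurable_bisolution_mul_right (F : FundamentalSystem v h) {x : ℝ}
    (hx : 0 < x) :
    AEStronglyMeasurable (fun y => bisolution h x y * Q y) (volume.restrict E) :=
  ((F.continuousOn_bisolution.comp (f := fun y => (x, y)) (by fun_prop)
    fun y hy => ⟨hx, hE0 hy⟩).aestronglyMeasurable hE).mul hQ

end Measurability

theorem mul_deriv_sub_deriv_mul (F : FundamentalSystem v h) {x : ℝ} (hx : 0 < x) :
    h.1 x * deriv h.2 x - deriv h.1 x * h.2 x = wronskian h.1 h.2 1 :=
  F.fst.wronskian_eq F.snd one_pos hx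

theorem solvesODE_bisolution (F : FundamentalSystem v h) (x : ℝ) :
    SolvesODE v (bisolution h x) := by
  convert! F.snd.linear_combination F.fst (h.1 x / wronskian h.1 h.2 1)
    (-(h.2 x / wronskian h.1 h.2 1)) using 2
  rw [bisolution]
  ring

theorem solvesODE_bisolutionDeriv (F : FundamentalSystem v h) (x : ℝ) :
    SolvesODE v (bisolutionDeriv h x) := by
  convert! F.snd.linear_combination F.fst (deriv h.1 x / wronskian h.1 h.2 1)
    (-(deriv h.2 x / wronskian h.1 h.2 1)) using 2
  rw [bisolutionDeriv]
  ring

theorem deriv_bisolution_self (F : FundamentalSystem v h) {x : ℝ} (hx : 0 < x) :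
    deriv (bisolution h x) x = 1 := by
  have := (((F.snd.hasDerivAt hx).const_mul (h.1 x)).sub
    ((F.fst.hasDerivAt hx).const_mul (h.2 x))).div_const (wronskian h.1 h.2 1)
  refine this.deriv.trans ?_
  rw [div_eq_one_iff_eq F.wronskian_ne_zero, ← F.mul_deriv_sub_deriv_mul hx]
  ring

theorem bisolutionDeriv_self (F : FundamentalSystem v h) {x : ℝ} (hx : 0 < x) :
    bisolutionDeriv h x x = -1 := by
  rw [bisolutionDeriv, div_eq_iff F.wronskian_ne_zero, ← F.mul_deriv_sub_deriv_mul hx]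
  ring

theorem deriv_bisolutionDeriv_self (F : FundamentalSystem v h) {x : ℝ} (hx : 0 < x) :
    deriv (bisolutionDeriv h x) x = 0 := by
  have := (((F.snd.hasDerivAt hx).const_mul (deriv h.1 x)).sub
    ((F.fst.hasDerivAt hx).const_mul (deriv h.2 x))).div_const (wronskian h.1 h.2 1)
  refine this.deriv.trans ?_
  rw [mul_comm, sub_self, zero_div]

theorem eq_bisolution_combination (F : FundamentalSystem v h) {e : ℝ → ℂ} (he : SolvesODE v e)
    {x y : ℝ} (hx : 0 < x) (hy : 0 < y) :
    e y = deriv e x * bisolution h x y - e x * bisolutionDeriv h x y := by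
  have h₁ := he.wronskian_eq F.fst hx hy
  have h₂ := he.wronskian_eq F.snd hx hy
  have hW := F.mul_deriv_sub_deriv_mul hy
  have hW0 := F.wronskian_ne_zero
  simp only [wronskian] at h₁ h₂
  rw [bisolution, bisolutionDeriv]
  field_simp
  linear_combination (-e y) * hW + h.1 y * h₂ - h.2 y * h₁

theorem exists_solvesODE_cauchyData_eq (F : FundamentalSystem v h) {κ : ℂ} {u : ℝ → ℂ}
    (hu : SolvesODE (fun x => v x + κ) u) {x : ℝ} (hx : 0 < x) :
    ∃ e : ℝ → ℂ, SolvesODE v e ∧ e x = u x ∧ deriv e x = deriv u x ∧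
      ∀ z, u z + volterraOp x (fun s t => bisolution h s t * κ) u z = e z := by
  have i : ∀ w : ℝ → ℂ, ContinuousOn w (Ioi 0) → ∀ z, 0 < z →
      IntervalIntegrable (fun t => w t * (κ * u t)) volume x z := fun w hw z hz =>
    ((hw.mul (continuousOn_const.mul hu.continuousOn)).mono
      (uIcc_subset_Ioi_zero hx hz)).intervalIntegrable
  have i₁ := i h.1 F.fst.continuousOn
  have i₂ := i h.2 F.snd.continuousOn
  refine ⟨_, F.solvesODE_add_volterraOp i₁ i₂ hu, ?_, ?_, fun z => ?_⟩
  · rw [volterraOp, intervalIntegral.integral_same, add_zero]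
  · rw [(F.hasDerivAt_add_volterraOp i₁ i₂ hu hx).deriv, volterraOp,
      intervalIntegral.integral_same, add_zero]
  · simp only [volterraOp, mul_assoc]

end FundamentalSystem

theorem bisolution_self (h : (ℝ → ℂ) × (ℝ → ℂ)) (x : ℝ) : bisolution h x x = 0 := by
  rw [bisolution, mul_comm, sub_self, zero_div]

theorem bisolution_swap (h : (ℝ → ℂ) × (ℝ → ℂ)) (x y : ℝ) :
    bisolution h x y = -bisolution h y x := by
  rw [bisolution, bisolution]
  ring

/-- Two positive continuous weights on `]0,∞[` whose product is bounded near `0`. They measure the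
growth at `0` of the bisolution of a second order equation in its smaller and larger argument. -/
structure WeightPair (ω η : ℝ → ℝ) : Prop where
  continuousOn_left : ContinuousOn ω (Ioi 0)
  continuousOn_right : ContinuousOn η (Ioi 0)
  pos_left : ∀ x, 0 < x → 0 < ω x
  pos_right : ∀ x, 0 < x → 0 < η x
  mul_le : ∀ a : ℝ, 0 < a → ∃ B : ℝ, 0 ≤ B ∧ ∀ x ∈ Ioo 0 a, η x * ω x ≤ B

section

variable {E : Type*} [SeminormedAddCommGroup E] {φ : ℝ → ℝ} {f : ℝ → E}
  (hφ : ContinuousOn φ (Ioi 0)) (hφ0 : ∀ x, 0 < x → 0 < φ x) (hf : ContinuousOn f (Ioi 0))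
include hφ hφ0 hf

theorem exists_norm_le_mul_of_continuousOn {a : ℝ} (ha : 0 < a) (b : ℝ) :
    ∃ M : ℝ, 0 ≤ M ∧ ∀ x ∈ Icc a b, ‖f x‖ ≤ φ x * M := by
  have hsub : Icc a b ⊆ Ioi 0 := fun x hx => ha.trans_le hx.1
  have hcont : ContinuousOn (fun x => ‖f x‖ / φ x) (Icc a b) :=
    (hf.norm.div hφ fun x hx => (hφ0 x hx).ne').mono hsub
  obtain ⟨M, hM⟩ := (isCompact_Icc.image_of_continuousOn hcont).bddAbove
  refine ⟨max 0 M, le_max_left _ _, fun x hx => ?_⟩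
  rw [← div_le_iff₀' (hφ0 x (hsub hx))]
  exact (hM (mem_image_of_mem _ hx)).trans (le_max_right _ _)

theorem exists_norm_le_mul_of_isBigO (h : f =O[𝓝[>] (0 : ℝ)] φ) (a : ℝ) :
    ∃ M : ℝ, 0 ≤ M ∧ ∀ x ∈ Ioo 0 a, ‖f x‖ ≤ φ x * M := by
  obtain ⟨c, hc0, hc⟩ := h.exists_nonneg
  obtain ⟨δ, hδ : 0 < δ, hsub⟩ := mem_nhdsGT_iff_exists_Ioo_subset.1 hc.bound
  obtain ⟨M, -, hM⟩ :=
    exists_norm_le_mul_of_continuousOn hφ hφ0 hf (half_pos hδ) a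
  refine ⟨max c M, le_max_of_le_left hc0, fun x hx => ?_⟩
  have hφx := hφ0 x hx.1
  rcases lt_or_ge x (δ / 2) with h | h
  · have hx' : ‖f x‖ ≤ c * ‖φ x‖ := hsub ⟨hx.1, by linarith⟩
    rw [Real.norm_of_nonneg hφx.le, mul_comm] at hx'
    exact hx'.trans (by gcongr; exact le_max_left _ _)
  · exact (hM x ⟨h, hx.2.le⟩).trans (by gcongr; exact le_max_right _ _)

end

/-- A fundamental system whose bisolution has, for `y ≤ x`, size `ω(y) η(x)`, its `x`-derivative
having size `ω(y) η(x) / x`. -/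
structure TamePair (v : ℝ → ℂ) (ω η : ℝ → ℝ) (h : (ℝ → ℂ) × (ℝ → ℂ)) : Prop
    extends FundamentalSystem v h where
  norm_bisolution_le : ∀ a : ℝ, 0 < a → ∃ C : ℝ, 0 ≤ C ∧ ∀ x y : ℝ, 0 < y → y ≤ x → x < a →
    ‖bisolution h x y‖ ≤ C * (ω y * η x) ∧ ‖bisolutionDeriv h x y‖ ≤ C * (ω y * (η x / x))

namespace TamePair

variable {v : ℝ → ℂ} {ω η : ℝ → ℝ} {p : (ℝ → ℂ) × (ℝ → ℂ)}

theorem exists_norm_le_cauchyData (T : TamePair v ω η p) {a : ℝ} (ha : 0 < a) :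
    ∃ C : ℝ, 0 ≤ C ∧ ∀ e : ℝ → ℂ, SolvesODE v e → ∀ x y : ℝ, 0 < y → y ≤ x → x < a →
      ‖e y‖ ≤ ω y * (C * η x * (‖e x‖ / x + ‖deriv e x‖)) := by
  obtain ⟨C, hC0, hC⟩ := T.norm_bisolution_le a ha
  refine ⟨C, hC0, fun e he x y hy hyx hxa => ?_⟩
  obtain ⟨h₁, h₂⟩ := hC x y hy hyx hxa
  calc ‖e y‖ = ‖deriv e x * bisolution p x y - e x * bisolutionDeriv p x y‖ := by
        rw [T.eq_bisolution_combination he (hy.trans_le hyx) hy]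
    _ ≤ ‖deriv e x‖ * (C * (ω y * η x)) + ‖e x‖ * (C * (ω y * (η x / x))) := by
        refine (norm_sub_le _ _).trans ?_
        rw [norm_mul, norm_mul]
        gcongr
    _ = ω y * (C * η x * (‖e x‖ / x + ‖deriv e x‖)) := by ring

theorem exists_norm_le (T : TamePair v ω η p) (hW : WeightPair ω η) {e : ℝ → ℂ}
    (he : SolvesODE v e) {a : ℝ} (ha : 0 < a) :
    ∃ C : ℝ, 0 ≤ C ∧ ∀ y ∈ Ioo 0 a, ‖e y‖ ≤ C * ω y := by
  obtain ⟨C, hC0, hC⟩ := T.exists_norm_le_cauchyData (a := a + 1) (by positivity)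
  have := hW.pos_right a ha
  refine ⟨C * η a * (‖e a‖ / a + ‖deriv e a‖), by positivity, fun y hy => ?_⟩
  rw [mul_comm]
  exact hC e he a y hy.1 hy.2.le (by linarith)

theorem volterraKernel_const (T : TamePair v ω η p) (hW : WeightPair ω η) {κ : ℂ} {a B C x y₀ : ℝ}
    (hB : ∀ z ∈ Ioo 0 a, η z * ω z ≤ B) (hB0 : 0 ≤ B) (hC0 : 0 ≤ C)
    (hC : ∀ x y : ℝ, 0 < y → y ≤ x → x < a → ‖bisolution p x y‖ ≤ C * (ω y * η x))
    (hy₀ : 0 < y₀) (hxa : x < a) :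
    VolterraKernel x (Icc y₀ x) (fun y z => bisolution p y z * κ) ω fun _ => C * B * ‖κ‖ where
  measurableSet := measurableSet_Icc
  uIoc_subset y hy := by
    rw [uIoc_of_ge hy.2]
    exact fun z hz => ⟨hy.1.trans hz.1.le, hz.2⟩
  weight_nonneg y hy := (hW.pos_left y (hy₀.trans_le hy.1)).le
  majorant_nonneg y _ := by positivity
  aestronglyMeasurable_right y hy := T.aestronglyMeasurable_bisolution_mul_right measurableSet_Icc
    (fun z hz => hy₀.trans_le hz.1) aestronglyMeasurable_const (hy₀.trans_le hy.1)
  aestronglyMeasurable := T.aestronglyMeasurable_bisolution_mul measurableSet_Icc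
    (fun z hz => hy₀.trans_le hz.1) aestronglyMeasurable_const
  intervalIntegrable y _ := intervalIntegrable_const
  norm_mul_le y hy z hz := by
    rw [uIoc_of_ge hy.2] at hz
    have hy0 : 0 < y := hy₀.trans_le hy.1
    have hza : z < a := hz.2.trans_lt hxa
    have := (hW.pos_left y hy0).le
    have := (hW.pos_left z (hy0.trans hz.1)).le
    calc ‖bisolution p y z * κ‖ * ω z ≤ C * (ω y * η z) * ‖κ‖ * ω z := by
          rw [norm_mul, bisolution_swap, norm_neg]
          gcongr
          exact hC z y hy0 hz.1.le hza
      _ = C * ω y * ‖κ‖ * (η z * ω z) := by ring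
      _ ≤ C * ω y * ‖κ‖ * B := by gcongr; exact hB z ⟨hy0.trans hz.1, hza⟩
      _ = ω y * (C * B * ‖κ‖) := by ring

theorem exists_norm_le_exp_of_norm_add_volterraOp_const_le (T : TamePair v ω η p)
    (hW : WeightPair ω η) (κ : ℂ) {a : ℝ} (ha : 0 < a) :
    ∃ L : ℝ, ∀ u : ℝ → ℂ, ContinuousOn u (Ioi 0) → ∀ x y D : ℝ, 0 < y → y ≤ x → x < a → 0 ≤ D →
      (∀ z ∈ Icc y x, ‖u z + volterraOp x (fun s t => bisolution p s t * κ) u z‖ ≤ ω z * D) →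
        ‖u y‖ ≤ ω y * (D * Real.exp L) := by
  obtain ⟨C, hC0, hC⟩ := T.norm_bisolution_le a ha
  obtain ⟨B, hB0, hB⟩ := hW.mul_le a ha
  refine ⟨C * B * ‖κ‖ * a, fun u hu x y D hy hyx hxa hD hbound => ?_⟩
  have V := T.volterraKernel_const hW (κ := κ) hB hB0 hC0
    (fun x y h₀ h₁ h₂ => (hC x y h₀ h₁ h₂).1) hy hxa
  have hyI : y ∈ Icc y x := left_mem_Icc.2 hyx
  obtain ⟨A, hA0, hA⟩ := exists_norm_le_mul_of_continuousOn hW.continuousOn_left hW.pos_left hu hy x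
  refine (V.norm_le_of_norm_add_volterraOp_le
    ((hu.mono fun z hz => hy.trans_le hz.1).aestronglyMeasurable measurableSet_Icc) hA0 hD
    (ae_restrict_of_forall_mem measurableSet_Icc hA)
    (ae_restrict_of_forall_mem measurableSet_Icc hbound) hyI
    (hbound y hyI)).trans ?_
  have hL : absPrimitive x (fun _ => C * B * ‖κ‖) y ≤ C * B * ‖κ‖ * a := by
    rw [absPrimitive, intervalIntegral.integral_const, smul_eq_mul, abs_mul,
      abs_of_nonneg (by positivity : 0 ≤ C * B * ‖κ‖), mul_comm, abs_sub_comm,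
      abs_of_nonneg (sub_nonneg.2 hyx)]
    gcongr
    linarith
  have := (hW.pos_left y hy).le
  gcongr

theorem exists_norm_le_cauchyData_add_const (T : TamePair v ω η p) (hW : WeightPair ω η) (κ : ℂ)
    {a : ℝ} (ha : 0 < a) :
    ∃ C : ℝ, 0 ≤ C ∧ ∀ u : ℝ → ℂ, SolvesODE (fun x => v x + κ) u →
      ∀ x y : ℝ, 0 < y → y ≤ x → x < a →
        ‖u y‖ ≤ ω y * (C * η x * (‖u x‖ / x + ‖deriv u x‖)) := by
  obtain ⟨C, hC0, hC⟩ := T.exists_norm_le_cauchyData ha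
  obtain ⟨L, hL⟩ := T.exists_norm_le_exp_of_norm_add_volterraOp_const_le hW κ ha
  refine ⟨C * Real.exp L, by positivity, fun u hu x y hy hyx hxa => ?_⟩
  have hx : 0 < x := hy.trans_le hyx
  obtain ⟨e, he, hex, hex', heq⟩ := T.exists_solvesODE_cauchyData_eq hu hx
  have hη := (hW.pos_right x hx).le
  calc ‖u y‖ ≤ ω y * (C * η x * (‖u x‖ / x + ‖deriv u x‖) * Real.exp L) := by
        refine hL u hu.continuousOn x y _ hy hyx hxa (by positivity) fun z hz => ?_
        rw [heq, ← hex, ← hex']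
        exact hC e he x z (hy.trans_le hz.1) hz.2 hxa
    _ = _ := by ring

end TamePair

theorem TamePair.add_const {κ : ℂ} {v : ℝ → ℂ} {ω η : ℝ → ℝ} {p h : (ℝ → ℂ) × (ℝ → ℂ)}
    (T : TamePair v ω η p) (hW : WeightPair ω η) (F : FundamentalSystem (fun x => v x + κ) h) :
    TamePair (fun x => v x + κ) ω η h := by
  refine ⟨F, fun a ha => ?_⟩
  obtain ⟨C, hC0, hC⟩ := T.exists_norm_le_cauchyData_add_const hW κ ha
  refine ⟨C, hC0, fun x y hy hyx hxa => ⟨?_, ?_⟩⟩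
  · have := hC _ (F.solvesODE_bisolution x) x y hy hyx hxa
    rw [bisolution_self, F.deriv_bisolution_self (hy.trans_le hyx)] at this
    simpa [mul_left_comm] using this
  · have := hC _ (F.solvesODE_bisolutionDeriv x) x y hy hyx hxa
    rw [F.bisolutionDeriv_self (hy.trans_le hyx), F.deriv_bisolutionDeriv_self (hy.trans_le hyx)]
      at this
    simpa [div_eq_mul_inv, mul_assoc, mul_left_comm] using this

theorem besselPotential_zero_right (m k : ℂ) :
    besselPotential m k 0 = fun x => besselPotential m 0 0 x + k ^ 2 := by
  ext x
  simp [besselPotential]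

theorem tamePair_fundamentalPair {m : ℂ} {ω η : ℝ → ℝ} {p : (ℝ → ℂ) × (ℝ → ℂ)}
    (T : TamePair (besselPotential m 0 0) ω η p) (hW : WeightPair ω η) (k : ℂ) :
    TamePair (besselPotential m k 0) ω η (fundamentalPair m k) := by
  have F := fundamentalSystem_fundamentalPair m k
  rw [besselPotential_zero_right] at F ⊢
  exact T.add_const hW F

/-! ### The forward Green's operator in weighted spaces -/

section WeightedSpace

variable {φ : ℝ → ℝ} {a : ℝ} {f g : ℝ → ℂ}

theorem aestronglyMeasurable_weight (hφ : ContinuousOn φ (Ioi 0)) :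
    AEStronglyMeasurable (fun x => (φ x : ℂ)) (volume.restrict (Ioo 0 a)) :=
  (Complex.continuous_ofReal.comp_continuousOn (hφ.mono Ioo_subset_Ioi_self)).aestronglyMeasurable
    measurableSet_Ioo

section

variable (hφ0 : ∀ x, 0 < x → 0 < φ x)
include hφ0

theorem norm_div_weight_le_iff {x M : ℝ} (hx : 0 < x) :
    ‖f x / (φ x : ℂ)‖ ≤ M ↔ ‖f x‖ ≤ φ x * M := by
  rw [norm_div, Complex.norm_real, Real.norm_of_nonneg (hφ0 x hx).le, div_le_iff₀' (hφ0 x hx)]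

theorem ae_norm_le_weightedNorm (hf : f ∈ weightedLinfty a φ) :
    ∀ᵐ x ∂(volume.restrict (Ioo 0 a)), ‖f x‖ ≤ φ x * (weightedNorm a φ f).toReal := by
  filter_upwards [ae_le_eLpNormEssSup (f := fun x => f x / (φ x : ℂ))
    (μ := volume.restrict (Ioo 0 a)), ae_restrict_mem measurableSet_Ioo] with x hx hxa
  rw [← norm_div_weight_le_iff hφ0 hxa.1, ← toReal_enorm]
  rw [← eLpNorm_exponent_top] at hx
  exact ENNReal.toReal_mono hf.2.ne hx

theorem weightedNorm_le_mul (hg : g ∈ weightedLinfty a φ) {C : ℝ} (hC : 0 ≤ C)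
    (h : ∀ᵐ x ∂(volume.restrict (Ioo 0 a)), ‖f x‖ ≤ φ x * (C * (weightedNorm a φ g).toReal)) :
    weightedNorm a φ f ≤ ENNReal.ofReal C * weightedNorm a φ g := by
  rw [← ENNReal.ofReal_toReal (show weightedNorm a φ g ≠ ∞ from hg.2.ne), ← ENNReal.ofReal_mul hC,
    weightedNorm, eLpNorm_exponent_top]
  refine eLpNormEssSup_le_of_ae_bound ?_
  filter_upwards [h, ae_restrict_mem measurableSet_Ioo] with x hx hxa
  exact (norm_div_weight_le_iff hφ0 hxa.1).2 hx

theorem mem_weightedLinfty_iff (hφ : ContinuousOn φ (Ioi 0)) :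
    f ∈ weightedLinfty a φ ↔ AEStronglyMeasurable f (volume.restrict (Ioo 0 a)) ∧
      ∃ M : ℝ, 0 ≤ M ∧ ∀ᵐ x ∂(volume.restrict (Ioo 0 a)), ‖f x‖ ≤ φ x * M := by
  constructor
  · intro hf
    refine ⟨(hf.1.mul (aestronglyMeasurable_weight hφ)).congr ?_, _, ENNReal.toReal_nonneg,
      ae_norm_le_weightedNorm hφ0 hf⟩
    filter_upwards [ae_restrict_mem measurableSet_Ioo] with x hx
    exact div_mul_cancel₀ _ (Complex.ofReal_ne_zero.2 (hφ0 x hx.1).ne')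
  · rintro ⟨hm, M, -, hM⟩
    refine memLp_top_of_bound (hm.div₀ (aestronglyMeasurable_weight hφ)) M ?_
    filter_upwards [hM, ae_restrict_mem measurableSet_Ioo] with x hx hxa
    exact (norm_div_weight_le_iff hφ0 hxa.1).2 hx

theorem mem_weightedLinfty_of_isBigO (hφ : ContinuousOn φ (Ioi 0)) (hf : ContinuousOn f (Ioi 0))
    (h : f =O[𝓝[>] (0 : ℝ)] φ) (a : ℝ) : f ∈ weightedLinfty a φ := by
  obtain ⟨M, hM0, hM⟩ := exists_norm_le_mul_of_isBigO hφ hφ0 hf h a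
  exact (mem_weightedLinfty_iff hφ0 hφ).2
    ⟨(hf.mono Ioo_subset_Ioi_self).aestronglyMeasurable measurableSet_Ioo, M, hM0,
      ae_restrict_of_forall_mem measurableSet_Ioo hM⟩

theorem VolterraKernel.neumannSum_mem_weightedLinfty {K : ℝ → ℝ → ℂ} {ρ : ℝ → ℝ} {L : ℝ}
    (V : VolterraKernel 0 (Ioo 0 a) K φ ρ) (hφ : ContinuousOn φ (Ioi 0))
    (hL : ∀ x ∈ Ioo 0 a, absPrimitive 0 ρ x ≤ L) (hf : f ∈ weightedLinfty a φ) :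
    neumannSum 0 K f ∈ weightedLinfty a φ := by
  obtain ⟨hfm, M, hM, hfM⟩ := (mem_weightedLinfty_iff hφ0 hφ).1 hf
  refine (mem_weightedLinfty_iff hφ0 hφ).2
    ⟨V.aestronglyMeasurable_neumannSum hfm hM hfM, M * Real.exp L, by positivity, ?_⟩
  filter_upwards [hfM, ae_restrict_mem measurableSet_Ioo] with x hfx hx
  have hφx := V.weight_nonneg x hx
  refine (V.norm_neumannSum_le hfm hM hfM hx hfx).trans ?_
  gcongr
  exact hL x hx

end

end WeightedSpace

section GreenIntegral

theorem forwardGreen_mul_eq_indicator (m k : ℂ) (Q f : ℝ → ℂ) (x : ℝ) :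
    (fun y => forwardGreen m k x y * (Q y * f y)) =
      (Iic x).indicator fun y => bisolution (fundamentalPair m k) x y * Q y * f y := by
  ext y
  by_cases h : y ≤ x <;> simp [forwardGreen, h, mul_assoc, canonicalBisolution, bisolution]

variable {m k : ℂ} {Q : ℝ → ℂ} {x : ℝ} (hx : 0 < x)
include hx

theorem greenQ_eq_volterraOp (f : ℝ → ℂ) : greenQ m k Q f x =
    volterraOp 0 (fun x y => bisolution (fundamentalPair m k) x y * Q y) f x := by
  rw [greenQ, forwardGreen_mul_eq_indicator, setIntegral_indicator measurableSet_Iic, Ioi_inter_Iic,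
    volterraOp, intervalIntegral.integral_of_le hx.le]

theorem integrableOn_forwardGreen_mul_iff {f : ℝ → ℂ} :
    IntegrableOn (fun y => forwardGreen m k x y * (Q y * f y)) (Ioi 0) ↔
      IntervalIntegrable (fun y => bisolution (fundamentalPair m k) x y * Q y * f y)
        volume 0 x := by
  rw [forwardGreen_mul_eq_indicator, intervalIntegrable_iff_integrableOn_Ioc_of_le hx.le,
    IntegrableOn, integrable_indicator_iff measurableSet_Iic, IntegrableOn,
    Measure.restrict_restrict measurableSet_Iic, inter_comm, Ioi_inter_Iic, IntegrableOn]

end GreenIntegral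

section Invertibility

variable {m k : ℂ} {Q : ℝ → ℂ} {φ ρ : ℝ → ℝ} {a L : ℝ} {f : ℝ → ℂ}

theorem ae_greenQ_eq_volterraOp (m k : ℂ) (Q f : ℝ → ℂ) (a : ℝ) :
    ∀ᵐ x ∂(volume.restrict (Ioo 0 a)), greenQ m k Q f x =
      volterraOp 0 (fun x y => bisolution (fundamentalPair m k) x y * Q y) f x := by
  filter_upwards [ae_restrict_mem measurableSet_Ioo] with x hx
  exact greenQ_eq_volterraOp hx.1 f

variable
  (V : VolterraKernel 0 (Ioo 0 a) (fun x y => bisolution (fundamentalPair m k) x y * Q y) φ ρ)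
  (hL : ∀ x ∈ Ioo 0 a, absPrimitive 0 ρ x ≤ L)
include V hL

theorem ae_norm_greenQ_le (hf : AEStronglyMeasurable f (volume.restrict (Ioo 0 a))) {M : ℝ}
    (hM : 0 ≤ M) (hfM : ∀ᵐ x ∂(volume.restrict (Ioo 0 a)), ‖f x‖ ≤ φ x * M) :
    ∀ᵐ x ∂(volume.restrict (Ioo 0 a)), ‖greenQ m k Q f x‖ ≤ φ x * (L * M) := by
  filter_upwards [ae_greenQ_eq_volterraOp m k Q f a, ae_restrict_mem measurableSet_Ioo]
    with x hxg hx
  have hφx := V.weight_nonneg x hx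
  rw [hxg, mul_comm L]
  refine (V.norm_volterraOp_le hf hM hfM hx).trans ?_
  gcongr
  exact hL x hx

variable (hφ : ContinuousOn φ (Ioi 0)) (hφ0 : ∀ x, 0 < x → 0 < φ x)
include hφ hφ0

theorem exists_add_greenQ_eq (hf : f ∈ weightedLinfty a φ) :
    ∃ h ∈ weightedLinfty a φ,
      ∀ᵐ x ∂(volume.restrict (Ioo 0 a)), h x + greenQ m k Q h x = f x := by
  obtain ⟨hfm, M, hM, hfM⟩ := (mem_weightedLinfty_iff hφ0 hφ).1 hf
  refine ⟨_, V.neumannSum_mem_weightedLinfty hφ0 hφ hL hf, ?_⟩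
  filter_upwards [ae_greenQ_eq_volterraOp m k Q _ a, ae_restrict_mem measurableSet_Ioo]
    with x hxg hx
  rw [hxg]
  exact V.neumannSum_add_volterraOp hfm hM hfM hx

variable (hL0 : 0 ≤ L)
include hL0

theorem greenQ_mem_weightedLinfty (hf : f ∈ weightedLinfty a φ) :
    greenQ m k Q f ∈ weightedLinfty a φ := by
  obtain ⟨hfm, M, hM, hfM⟩ := (mem_weightedLinfty_iff hφ0 hφ).1 hf
  exact (mem_weightedLinfty_iff hφ0 hφ).2 ⟨(V.aestronglyMeasurable_volterraOp hfm).congr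
    ((ae_greenQ_eq_volterraOp m k Q f a).mono fun _ h => h.symm), L * M, by positivity,
    ae_norm_greenQ_le V hL hfm hM hfM⟩

theorem weightedNorm_le_mul_weightedNorm_add_greenQ (hf : f ∈ weightedLinfty a φ) :
    weightedNorm a φ f ≤
      ENNReal.ofReal (Real.exp L) * weightedNorm a φ fun x => f x + greenQ m k Q f x := by
  obtain ⟨hfm, M, hM, hfM⟩ := (mem_weightedLinfty_iff hφ0 hφ).1 hf
  have hadd : (fun x => f x + greenQ m k Q f x) ∈ weightedLinfty a φ := by
    simp only [weightedLinfty, mem_ofPred_eq, add_div]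
    exact MemLp.add hf (greenQ_mem_weightedLinfty V hL hφ hφ0 hL0 hf)
  have hbound := (ae_norm_le_weightedNorm hφ0 hadd).and (ae_greenQ_eq_volterraOp m k Q f a)
  refine weightedNorm_le_mul hφ0 hadd (Real.exp_pos L).le ?_
  have hbound' := hbound.mono fun x hx => hx.2 ▸ hx.1
  filter_upwards [hbound', ae_restrict_mem measurableSet_Ioo] with x hxB hx
  have hφx := V.weight_nonneg x hx
  rw [mul_comm (Real.exp L)]
  refine (V.norm_le_of_norm_add_volterraOp_le hfm hM ENNReal.toReal_nonneg hfM hbound' hx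
    hxB).trans ?_
  gcongr
  exact hL x hx

theorem oneAddGreenInvertible_of_volterraKernel : OneAddGreenInvertible m k Q a φ where
  integrable f hf x hx := by
    obtain ⟨hfm, M, hM, hfM⟩ := (mem_weightedLinfty_iff hφ0 hφ).1 hf
    exact (integrableOn_forwardGreen_mul_iff hx.1).2 (V.intervalIntegrable_mul hfm hM hfM hx)
  mapsTo _ := greenQ_mem_weightedLinfty V hL hφ hφ0 hL0
  bounded := ⟨ENNReal.ofReal L, ENNReal.ofReal_ne_top, fun f hf =>
    weightedNorm_le_mul hφ0 hf hL0 (ae_norm_greenQ_le V hL ((mem_weightedLinfty_iff hφ0 hφ).1 hf).1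
      ENNReal.toReal_nonneg (ae_norm_le_weightedNorm hφ0 hf))⟩
  surjective _ := exists_add_greenQ_eq V hL hφ hφ0
  bounded_inverse := ⟨ENNReal.ofReal (Real.exp L), ENNReal.ofReal_ne_top, fun _ =>
    weightedNorm_le_mul_weightedNorm_add_greenQ V hL hφ hφ0 hL0⟩

end Invertibility

section Smallness

theorem tendsto_integral_nhdsGT_zero {F : ℝ → ℝ} (hF : IntegrableOn F (Ioo 0 1)) :
    Tendsto (fun x => ∫ y in (0 : ℝ)..x, F y) (𝓝[>] 0) (𝓝 0) := by
  have hF' : IntervalIntegrable F volume 0 1 :=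
    (intervalIntegrable_iff_integrableOn_Ioo_of_le zero_le_one).2 hF
  have h := intervalIntegral.continuousOn_primitive_interval' hF' left_mem_uIcc 0 left_mem_uIcc
  rw [uIcc_of_le zero_le_one, ContinuousWithinAt, intervalIntegral.integral_same] at h
  rw [← nhdsWithin_Ioo_eq_nhdsGT (zero_lt_one (α := ℝ))]
  exact h.mono_left (nhdsWithin_mono _ Ioo_subset_Icc_self)

variable {F : ℝ → ℝ} {ε : ℝ} (hε : 0 ≤ ε) (hF : ∀ y ∈ Ioo (0 : ℝ) 1, 0 ≤ F y)
  (hFi : IntegrableOn F (Ioo 0 1)) (hi : IntegrableOn (fun y => y ^ (-ε) * F y) (Ioo 0 1))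
include hε hF hFi hi

theorem integral_le_rpow_mul_integral {x : ℝ} (hx : x ∈ Ioo (0 : ℝ) 1) :
    ∫ y in (0 : ℝ)..x, F y ≤ x ^ ε * ∫ y in (0 : ℝ)..x, y ^ (-ε) * F y := by
  have hsub : Ioc 0 x ⊆ Ioo 0 1 := fun y hy => ⟨hy.1, hy.2.trans_lt hx.2⟩
  rw [← intervalIntegral.integral_const_mul, intervalIntegral.integral_of_le hx.1.le,
    intervalIntegral.integral_of_le hx.1.le]
  refine setIntegral_mono_on (hFi.mono_set hsub) ((hi.mono_set hsub).const_mul _)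
    measurableSet_Ioc fun y hy => ?_
  have hFy := hF y (hsub hy)
  have hyε := Real.rpow_nonneg hy.1.le (-ε)
  calc F y = y ^ ε * (y ^ (-ε) * F y) := by
        rw [← mul_assoc, ← Real.rpow_add hy.1, add_neg_cancel, Real.rpow_zero, one_mul]
    _ ≤ x ^ ε * (y ^ (-ε) * F y) := by
        gcongr
        exacts [hy.1.le, hy.2]

theorem isLittleO_integral_rpow :
    (fun x => ∫ y in (0 : ℝ)..x, F y) =o[𝓝[>] (0 : ℝ)] fun x => x ^ ε := by
  have h : (fun x => x ^ ε * ∫ y in (0 : ℝ)..x, y ^ (-ε) * F y) =o[𝓝[>] (0 : ℝ)]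
      fun x => x ^ ε := by
    simpa using (isBigO_refl (fun x : ℝ => x ^ ε) _).mul_isLittleO
      ((isLittleO_one_iff ℝ).2 (tendsto_integral_nhdsGT_zero hi))
  refine (IsBigO.of_bound' ?_).trans_isLittleO h
  filter_upwards [Ioo_mem_nhdsGT (zero_lt_one (α := ℝ))] with x hx
  have hnn : 0 ≤ ∫ y in (0 : ℝ)..x, F y := by
    rw [intervalIntegral.integral_of_le hx.1.le]
    exact setIntegral_nonneg measurableSet_Ioc fun y hy => hF y ⟨hy.1, hy.2.trans_lt hx.2⟩
  have hle := integral_le_rpow_mul_integral hε hF hFi hi hx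
  rwa [Real.norm_of_nonneg hnn, Real.norm_of_nonneg (hnn.trans hle)]

theorem isLittleO_of_norm_le_rpow_mul_integral {f : ℝ → ℂ} {C τ : ℝ}
    (hf : ∀ x ∈ Ioo (0 : ℝ) 1, ‖f x‖ ≤ C * (x ^ τ * ∫ y in (0 : ℝ)..x, F y)) :
    f =o[𝓝[>] (0 : ℝ)] fun x => x ^ (τ + ε) := by
  have h := (((isBigO_refl (fun x : ℝ => x ^ τ) _).mul_isLittleO
    (isLittleO_integral_rpow hε hF hFi hi)).const_mul_left C)
  refine ((IsBigO.of_norm_eventuallyLE ?_).trans_isLittleO h).congr' EventuallyEq.rfl ?_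
  · filter_upwards [Ioo_mem_nhdsGT (zero_lt_one (α := ℝ))] using hf
  · filter_upwards [self_mem_nhdsWithin] with x hx
    exact (Real.rpow_add hx _ _).symm

end Smallness

/-- A weight `φ`, at least as large as `η` at `0`, against which the locally integrable potential
`Q` is integrable at `0` together with the weight `ω`. Then `1 + G⁰_→ Q` is invertible on
`L^∞(]0,a[, φ)` as soon as the bisolution is controlled by `ω` and `η`. -/
structure AdmissibleWeight (ω η : ℝ → ℝ) (Q : ℝ → ℂ) (φ : ℝ → ℝ) : Prop where
  locallyIntegrableOn : LocallyIntegrableOn Q (Ioi 0)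
  continuousOn : ContinuousOn φ (Ioi 0)
  pos : ∀ x, 0 < x → 0 < φ x
  isBigO : η =O[𝓝[>] (0 : ℝ)] φ
  integrableOn : IntegrableOn (fun y => ω y * φ y * ‖Q y‖) (Ioo 0 1)

namespace AdmissibleWeight

variable {ω η φ : ℝ → ℝ} {Q f : ℝ → ℂ}

theorem aestronglyMeasurable (A : AdmissibleWeight ω η Q φ) (a : ℝ) :
    AEStronglyMeasurable Q (volume.restrict (Ioo 0 a)) :=
  A.locallyIntegrableOn.aestronglyMeasurable.mono_set Ioo_subset_Ioi_self

variable (hW : WeightPair ω η)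
include hW

theorem majorant_nonneg (A : AdmissibleWeight ω η Q φ) {y : ℝ} (hy : 0 < y) :
    0 ≤ ω y * φ y * ‖Q y‖ :=
  mul_nonneg (mul_pos (hW.pos_left y hy) (A.pos y hy)).le (norm_nonneg _)

theorem intervalIntegrable (A : AdmissibleWeight ω η Q φ) {a : ℝ} (ha : 0 < a) :
    IntervalIntegrable (fun y => ω y * φ y * ‖Q y‖) volume 0 a := by
  have hsub : Icc 1 (max 1 a) ⊆ Ioi (0 : ℝ) := fun x hx => zero_lt_one.trans_le hx.1
  have h : IntegrableOn (fun y => ω y * φ y * ‖Q y‖) (Icc 1 (max 1 a)) :=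
    IntegrableOn.continuousOn_mul ((hW.continuousOn_left.mul A.continuousOn).mono hsub)
      (A.locallyIntegrableOn.integrableOn_compact_subset hsub isCompact_Icc).norm isCompact_Icc
  refine (intervalIntegrable_iff_integrableOn_Ioo_of_le ha.le).2
    ((A.integrableOn.union h).mono_set fun x hx => ?_)
  rcases lt_or_ge x 1 with hx1 | hx1
  · exact Or.inl ⟨hx.1, hx1⟩
  · exact Or.inr ⟨hx1, hx.2.le.trans (le_max_right _ _)⟩

theorem self (A : AdmissibleWeight ω η Q φ) : AdmissibleWeight ω η Q η where
  locallyIntegrableOn := A.locallyIntegrableOn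
  continuousOn := hW.continuousOn_right
  pos := hW.pos_right
  isBigO := isBigO_refl _ _
  integrableOn := by
    obtain ⟨C, -, hC⟩ :=
      exists_norm_le_mul_of_isBigO A.continuousOn A.pos hW.continuousOn_right A.isBigO 1
    refine (A.integrableOn.const_mul C).mono'
      (((hW.continuousOn_left.mul hW.continuousOn_right).mono
        Ioo_subset_Ioi_self).aestronglyMeasurable measurableSet_Ioo |>.mul
          (A.aestronglyMeasurable 1).norm) ?_
    filter_upwards [ae_restrict_mem measurableSet_Ioo] with y hy
    have hωy := (hW.pos_left y hy.1).le
    rw [norm_mul, norm_mul, norm_norm, Real.norm_of_nonneg hωy]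
    calc ω y * ‖η y‖ * ‖Q y‖ ≤ ω y * (φ y * C) * ‖Q y‖ := by
          gcongr
          exact hC y hy
      _ = C * (ω y * φ y * ‖Q y‖) := by ring

theorem add_const (A : AdmissibleWeight ω η Q η) (κ : ℂ) :
    AdmissibleWeight ω η (fun x => Q x + κ) η where
  locallyIntegrableOn :=
    A.locallyIntegrableOn.add (continuousOn_const.locallyIntegrableOn measurableSet_Ioi)
  continuousOn := A.continuousOn
  pos := A.pos
  isBigO := A.isBigO
  integrableOn := by
    obtain ⟨B, -, hB⟩ := hW.mul_le 1 one_pos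
    refine (A.integrableOn.add (integrable_const (B * ‖κ‖))).mono'
      (((hW.continuousOn_left.mul hW.continuousOn_right).mono
        Ioo_subset_Ioi_self).aestronglyMeasurable measurableSet_Ioo |>.mul
          ((A.aestronglyMeasurable 1).add aestronglyMeasurable_const).norm) ?_
    filter_upwards [ae_restrict_mem measurableSet_Ioo] with y hy
    have hωη := mul_pos (hW.pos_left y hy.1) (hW.pos_right y hy.1)
    rw [norm_mul, norm_norm, Real.norm_of_nonneg hωη.le]
    calc ω y * η y * ‖Q y + κ‖ ≤ ω y * η y * ‖Q y‖ + η y * ω y * ‖κ‖ := by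
          rw [mul_comm (η y), ← mul_add]
          gcongr
          exact norm_add_le _ _
      _ ≤ ω y * η y * ‖Q y‖ + B * ‖κ‖ := by
          gcongr
          exact hB y hy

end AdmissibleWeight

section WeightedIntegral

variable {ω η φ : ℝ → ℝ} {Q f k : ℝ → ℂ} {x τ M : ℝ} (hk : ∀ y ∈ Ioo 0 x, ‖k y‖ ≤ τ * ω y)
  (hf : ∀ᵐ y ∂(volume.restrict (Ioo 0 x)), ‖f y‖ ≤ φ y * M)
include hk hf

theorem ae_norm_mul_mul_le (Q : ℝ → ℂ) :
    ∀ᵐ y ∂(volume.restrict (Ioo 0 x)), ‖k y * (Q y * f y)‖ ≤ τ * M * (ω y * φ y * ‖Q y‖) := by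
  filter_upwards [hf, ae_restrict_mem measurableSet_Ioo] with y hfy hy
  have hky := hk y hy
  rw [norm_mul, norm_mul]
  calc ‖k y‖ * (‖Q y‖ * ‖f y‖) ≤ τ * ω y * (‖Q y‖ * (φ y * M)) := by
        gcongr
        exact (norm_nonneg _).trans hky
    _ = τ * M * (ω y * φ y * ‖Q y‖) := by ring

variable (hW : WeightPair ω η) (hx : 0 < x)
include hW hx

theorem AdmissibleWeight.intervalIntegrable_mul (A : AdmissibleWeight ω η Q φ)
    (hkc : ContinuousOn k (Ioi 0)) (hfm : AEStronglyMeasurable f (volume.restrict (Ioo 0 x))) :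
    IntervalIntegrable (fun y => k y * (Q y * f y)) volume 0 x := by
  have hF := (A.intervalIntegrable hW hx).const_mul (τ * M)
  rw [intervalIntegrable_iff_integrableOn_Ioo_of_le hx.le] at hF ⊢
  exact hF.mono' (((hkc.mono Ioo_subset_Ioi_self).aestronglyMeasurable measurableSet_Ioo).mul
    ((A.aestronglyMeasurable x).mul hfm)) (ae_norm_mul_mul_le hk hf Q)

theorem AdmissibleWeight.norm_integral_mul_le (A : AdmissibleWeight ω η Q φ) :
    ‖∫ y in (0 : ℝ)..x, k y * (Q y * f y)‖ ≤
      τ * M * ∫ y in (0 : ℝ)..x, ω y * φ y * ‖Q y‖ := by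
  have hF := (A.intervalIntegrable hW hx).const_mul (τ * M)
  rw [← intervalIntegral.integral_const_mul]
  refine intervalIntegral.norm_integral_le_of_norm_le hx.le ?_ hF
  rw [← ae_restrict_iff' measurableSet_Ioc, ← restrict_Ioo_eq_restrict_Ioc]
  exact ae_norm_mul_mul_le hk hf Q

end WeightedIntegral

namespace TamePair

variable {v Q f : ℝ → ℂ} {ω η φ : ℝ → ℝ} {h : (ℝ → ℂ) × (ℝ → ℂ)}

theorem exists_volterraKernel (T : TamePair v ω η h) (hW : WeightPair ω η)
    (A : AdmissibleWeight ω η Q φ) {a : ℝ} (ha : 0 < a) :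
    ∃ (ρ : ℝ → ℝ) (L : ℝ), 0 ≤ L ∧
      VolterraKernel 0 (Ioo 0 a) (fun x y => bisolution h x y * Q y) φ ρ ∧
      ∀ x ∈ Ioo 0 a, absPrimitive 0 ρ x ≤ L := by
  obtain ⟨C, hC0, hC⟩ := T.norm_bisolution_le a ha
  obtain ⟨C', hC'0, hC'⟩ :=
    exists_norm_le_mul_of_isBigO A.continuousOn A.pos hW.continuousOn_right A.isBigO a
  have hρ0 : ∀ y, 0 < y → 0 ≤ C * C' * (ω y * φ y * ‖Q y‖) := fun y hy =>
    mul_nonneg (mul_nonneg hC0 hC'0) (A.majorant_nonneg hW hy)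
  have hρ : ∀ x, 0 < x → IntervalIntegrable (fun y => C * C' * (ω y * φ y * ‖Q y‖)) volume 0 x :=
    fun x hx => (A.intervalIntegrable hW hx).const_mul _
  refine ⟨fun y => C * C' * (ω y * φ y * ‖Q y‖), absPrimitive 0 _ a, absPrimitive_nonneg _ _ _, ?_,
    fun x hx => absPrimitive_mono (hρ a ha) (fun y hy => hρ0 y ?_) ?_⟩
  · refine ⟨measurableSet_Ioo, fun x hx => ?_, fun x hx => (A.pos x hx.1).le,
      fun y hy => hρ0 y hy.1, fun x hx => ?_, ?_, fun x hx => hρ x hx.1, fun x hx y hy => ?_⟩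
    · rw [uIoc_of_le hx.1.le]
      exact fun y hy => ⟨hy.1, hy.2.trans_lt hx.2⟩
    · exact T.aestronglyMeasurable_bisolution_mul_right measurableSet_Ioo Ioo_subset_Ioi_self
        (A.aestronglyMeasurable a) hx.1
    · exact T.aestronglyMeasurable_bisolution_mul measurableSet_Ioo Ioo_subset_Ioi_self
        (A.aestronglyMeasurable a)
    · rw [uIoc_of_le hx.1.le] at hy
      have hφy := (A.pos y hy.1).le
      have hωy := (hW.pos_left y hy.1).le
      calc ‖bisolution h x y * Q y‖ * φ y ≤ C * (ω y * (φ x * C')) * ‖Q y‖ * φ y := by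
            rw [norm_mul]
            gcongr
            refine (hC x y hy.1 hy.2 hx.2).1.trans ?_
            gcongr
            exact (Real.le_norm_self _).trans (hC' x hx)
        _ = φ x * (C * C' * (ω y * φ y * ‖Q y‖)) := by ring
  · rw [uIoc_of_le ha.le] at hy
    exact hy.1
  · rw [uIoc_of_le ha.le]
    exact ⟨hx.1, hx.2.le⟩

section

variable (hW : WeightPair ω η) (A : AdmissibleWeight ω η Q φ)
include hW A

theorem intervalIntegrable_mul (T : TamePair v ω η h) (hf : ∀ a, 0 < a → f ∈ weightedLinfty a φ)
    {e : ℝ → ℂ} (he : SolvesODE v e) {x : ℝ} (hx : 0 < x) :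
    IntervalIntegrable (fun y => e y * (Q y * f y)) volume 0 x := by
  obtain ⟨C, -, hC⟩ := T.exists_norm_le hW he hx
  obtain ⟨hfm, M, -, hfM⟩ := (mem_weightedLinfty_iff A.pos A.continuousOn).1 (hf x hx)
  exact A.intervalIntegrable_mul hC hfM hW hx he.continuousOn hfm

theorem exists_norm_volterraOp_le (T : TamePair v ω η h) (hf : f ∈ weightedLinfty 1 φ) :
    ∃ C : ℝ, ∀ x ∈ Ioo (0 : ℝ) 1,
      ‖volterraOp 0 (bisolution h) (fun y => Q y * f y) x‖ ≤
        C * (η x * ∫ y in (0 : ℝ)..x, ω y * φ y * ‖Q y‖) ∧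
      ‖volterraOp 0 (bisolutionDeriv h) (fun y => Q y * f y) x‖ ≤
        C * (η x / x * ∫ y in (0 : ℝ)..x, ω y * φ y * ‖Q y‖) := by
  obtain ⟨C, -, hC⟩ := T.norm_bisolution_le 1 one_pos
  obtain ⟨-, M, -, hfM⟩ := (mem_weightedLinfty_iff A.pos A.continuousOn).1 hf
  refine ⟨C * M, fun x hx => ?_⟩
  have hfx := ae_restrict_of_ae_restrict_of_subset (Ioo_subset_Ioo_right hx.2.le) hfM
  have hk₁ : ∀ y ∈ Ioo 0 x, ‖bisolution h x y‖ ≤ C * η x * ω y := fun y hy => by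
    simpa only [mul_assoc, mul_comm (η x)] using (hC x y hy.1 hy.2.le hx.2).1
  have hk₂ : ∀ y ∈ Ioo 0 x, ‖bisolutionDeriv h x y‖ ≤ C * (η x / x) * ω y := fun y hy => by
    simpa only [mul_assoc, mul_comm (η x / x)] using (hC x y hy.1 hy.2.le hx.2).2
  constructor
  · refine (A.norm_integral_mul_le hk₁ hfx hW hx.1).trans_eq ?_
    ring
  · refine (A.norm_integral_mul_le hk₂ hfx hW hx.1).trans_eq ?_
    ring

theorem exists_add_volterraOp_eq (T : TamePair v ω η h) {g₀ : ℝ → ℂ}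
    (hg₀ : ∀ a, 0 < a → g₀ ∈ weightedLinfty a φ) :
    ∃ g : ℝ → ℂ, (∀ a, 0 < a → g ∈ weightedLinfty a φ) ∧ ∀ x, 0 < x →
      g x + volterraOp 0 (fun x y => bisolution h x y * Q y) g x = g₀ x := by
  refine ⟨neumannSum 0 (fun x y => bisolution h x y * Q y) g₀, fun a ha => ?_, fun x hx => ?_⟩
  · obtain ⟨ρ, L, -, V, hL⟩ := T.exists_volterraKernel hW A ha
    exact V.neumannSum_mem_weightedLinfty A.pos A.continuousOn hL (hg₀ a ha)
  · obtain ⟨ρ, L, -, V, -⟩ := T.exists_volterraKernel hW A (add_pos hx one_pos)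
    obtain ⟨hm, M, hM0, hM⟩ :=
      (mem_weightedLinfty_iff A.pos A.continuousOn).1 (hg₀ _ (add_pos hx one_pos))
    exact V.neumannSum_add_volterraOp hm hM0 hM ⟨hx, lt_add_one x⟩

end

end TamePair

theorem TamePair.isLittleO_volterraOp {v Q f : ℝ → ℂ} {ω φ : ℝ → ℝ} {h : (ℝ → ℂ) × (ℝ → ℂ)}
    {σ ε : ℝ} (T : TamePair v ω (fun x => x ^ σ) h) (hW : WeightPair ω fun x => x ^ σ)
    (A : AdmissibleWeight ω (fun x => x ^ σ) Q φ) (hf : f ∈ weightedLinfty 1 φ) (hε : 0 ≤ ε)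
    (hi : IntegrableOn (fun y => y ^ (-ε) * (ω y * φ y * ‖Q y‖)) (Ioo 0 1)) :
    volterraOp 0 (bisolution h) (fun y => Q y * f y) =o[𝓝[>] (0 : ℝ)] (fun x => x ^ (σ + ε)) ∧
      volterraOp 0 (bisolutionDeriv h) (fun y => Q y * f y) =o[𝓝[>] (0 : ℝ)]
        (fun x => x ^ (σ + ε - 1)) := by
  obtain ⟨C, hC⟩ := T.exists_norm_volterraOp_le hW A hf
  have hF : ∀ y ∈ Ioo (0 : ℝ) 1, 0 ≤ ω y * φ y * ‖Q y‖ := fun y hy => A.majorant_nonneg hW hy.1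
  refine ⟨isLittleO_of_norm_le_rpow_mul_integral hε hF A.integrableOn hi
    fun x hx => (hC x hx).1, ?_⟩
  rw [add_sub_right_comm]
  refine isLittleO_of_norm_le_rpow_mul_integral (C := C) hε hF A.integrableOn hi
    fun x hx => ?_
  rw [Real.rpow_sub_one hx.1.ne']
  exact (hC x hx).2

/-! ### Principal solutions and uniqueness -/

theorem volterraOp_mul_right (c : ℝ) (k : ℝ → ℝ → ℂ) (Q f : ℝ → ℂ) :
    volterraOp c (fun x y => k x y * Q y) f = volterraOp c k fun y => Q y * f y := by
  ext x
  simp only [volterraOp, mul_assoc]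

/-- A tame pair whose first component is a principal solution: it has size exactly `x ^ σ`, with
`σ ≥ 1 / 2`, and `x ^ σ` is also the growth of the bisolution in its larger argument. -/
structure PrincipalPair (v : ℝ → ℂ) (ω : ℝ → ℝ) (σ : ℝ) (p : (ℝ → ℂ) × (ℝ → ℂ)) : Prop
    extends TamePair v ω (fun x => x ^ σ) p where
  weightPair : WeightPair ω fun x => x ^ σ
  half_le : 1 / 2 ≤ σ
  norm_fst : ∀ x, 0 < x → ‖p.1 x‖ = x ^ σ
  isBigO_deriv_fst : deriv p.1 =O[𝓝[>] (0 : ℝ)] fun x => x ^ (σ - 1)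

namespace FundamentalSystem

variable {v e : ℝ → ℂ} {h : (ℝ → ℂ) × (ℝ → ℂ)} {x : ℝ}

theorem mul_wronskian_eq (F : FundamentalSystem v h) (he : SolvesODE v e) (hx : 0 < x) :
    e x * wronskian h.1 h.2 1 = h.1 x * wronskian e h.2 1 - h.2 x * wronskian e h.1 1 := by
  rw [← F.fst.wronskian_eq F.snd one_pos hx, ← he.wronskian_eq F.snd one_pos hx,
    ← he.wronskian_eq F.fst one_pos hx]
  simp only [wronskian]
  ring

theorem eq_const_mul_fst (F : FundamentalSystem v h) (he : SolvesODE v e)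
    (hW : wronskian e h.1 1 = 0) (hx : 0 < x) :
    e x = wronskian e h.2 1 / wronskian h.1 h.2 1 * h.1 x := by
  have := F.mul_wronskian_eq he hx
  rw [hW, mul_zero, sub_zero] at this
  rw [div_mul_eq_mul_div, eq_div_iff F.wronskian_ne_zero, this, mul_comm]

end FundamentalSystem

theorem isBigO_rpow_rpow_nhdsGT_zero {s t : ℝ} (hst : s ≤ t) :
    (fun x : ℝ => x ^ t) =O[𝓝[>] (0 : ℝ)] fun x => x ^ s := by
  refine IsBigO.of_bound' ?_
  filter_upwards [Ioo_mem_nhdsGT (zero_lt_one (α := ℝ))] with x hx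
  rw [Real.norm_of_nonneg (Real.rpow_nonneg hx.1.le _),
    Real.norm_of_nonneg (Real.rpow_nonneg hx.1.le _)]
  exact Real.rpow_le_rpow_of_exponent_ge hx.1 hx.2.le hst

theorem tendsto_wronskian_nhdsGT_zero {f g : ℝ → ℂ} {s t : ℝ} (hst : 1 ≤ s + t)
    (hf : f =o[𝓝[>] (0 : ℝ)] fun x => x ^ s) (hf' : deriv f =o[𝓝[>] (0 : ℝ)] fun x => x ^ (s - 1))
    (hg : g =O[𝓝[>] (0 : ℝ)] fun x => x ^ t)
    (hg' : deriv g =O[𝓝[>] (0 : ℝ)] fun x => x ^ (t - 1)) :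
    Tendsto (wronskian f g) (𝓝[>] 0) (𝓝 0) := by
  have hprod : ∀ {a b : ℝ}, 0 ≤ a + b →
      (fun x : ℝ => x ^ a * x ^ b) =O[𝓝[>] (0 : ℝ)] fun _ => (1 : ℝ) := fun {a b} hab => by
    refine (isBigO_rpow_rpow_nhdsGT_zero hab).congr' ?_ (by simp)
    filter_upwards [self_mem_nhdsWithin] with x hx
    exact Real.rpow_add hx a b
  exact (isLittleO_one_iff ℝ).1
    (((hf.mul_isBigO hg').trans_isBigO (hprod (by linarith))).sub
      ((hf'.mul_isBigO hg).trans_isBigO (hprod (by linarith))))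

namespace PrincipalPair

variable {v Q d : ℝ → ℂ} {ω : ℝ → ℝ} {σ : ℝ} {p : (ℝ → ℂ) × (ℝ → ℂ)}

theorem isTheta_fst (P : PrincipalPair v ω σ p) : p.1 =Θ[𝓝[>] (0 : ℝ)] fun x => x ^ σ := by
  refine IsTheta.of_norm_eventuallyEq_norm ?_
  filter_upwards [self_mem_nhdsWithin] with x (hx : 0 < x)
  rw [P.norm_fst x hx, Real.norm_of_nonneg (Real.rpow_nonneg hx.le _)]

theorem eq_zero_of_isLittleO (P : PrincipalPair v ω σ p) (hd : SolvesODE v d)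
    (h : d =o[𝓝[>] (0 : ℝ)] fun x => x ^ σ)
    (h' : deriv d =o[𝓝[>] (0 : ℝ)] fun x => x ^ (σ - 1)) {x : ℝ} (hx : 0 < x) : d x = 0 := by
  have hW : wronskian d p.1 1 = 0 := by
    refine tendsto_nhds_unique (tendsto_const_nhds.congr' ?_) (tendsto_wronskian_nhdsGT_zero
      (by linarith [P.half_le]) h h' P.isTheta_fst.isBigO P.isBigO_deriv_fst)
    filter_upwards [self_mem_nhdsWithin] with y hy
    exact (hd.wronskian_eq P.fst one_pos hy).symm
  have hp : ∃ᶠ y in 𝓝[>] (0 : ℝ), p.1 y ≠ 0 := by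
    refine Eventually.frequently ?_
    filter_upwards [self_mem_nhdsWithin] with y (hy : 0 < y)
    exact norm_ne_zero_iff.1 ((P.norm_fst y hy).trans_ne (Real.rpow_pos_of_pos hy σ).ne')
  have hdp : d =o[𝓝[>] (0 : ℝ)] p.1 := h.trans_isTheta P.isTheta_fst.symm
  rw [P.eq_const_mul_fst hd hW hx, mul_eq_zero]
  refine Or.inl (of_not_not fun hα => isLittleO_irrefl hp ((isLittleO_const_mul_left_iff hα).1
    (hdp.congr' ?_ EventuallyEq.rfl)))
  filter_upwards [self_mem_nhdsWithin] with y hy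
  exact P.eq_const_mul_fst hd hW hy

theorem add_volterraOp_eq_zero (P : PrincipalPair v ω σ p)
    (A : AdmissibleWeight ω (fun x => x ^ σ) Q fun x => x ^ σ)
    (hd : SolvesODE (fun x => v x + Q x) d) (h : d =o[𝓝[>] (0 : ℝ)] fun x => x ^ σ)
    (h' : deriv d =o[𝓝[>] (0 : ℝ)] fun x => x ^ (σ - 1)) {x : ℝ} (hx : 0 < x) :
    d x + volterraOp 0 (bisolution p) (fun y => Q y * d y) x = 0 := by
  have hmem : ∀ a, 0 < a → d ∈ weightedLinfty a fun x => x ^ σ := fun a _ =>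
    mem_weightedLinfty_of_isBigO A.pos A.continuousOn hd.continuousOn h.isBigO a
  have i₁ := fun x => P.intervalIntegrable_mul P.weightPair A hmem P.fst (x := x)
  have i₂ := fun x => P.intervalIntegrable_mul P.weightPair A hmem P.snd (x := x)
  obtain ⟨hV, hV'⟩ := P.isLittleO_volterraOp P.weightPair A (hmem 1 one_pos) le_rfl
    (by simpa only [neg_zero, Real.rpow_zero, one_mul] using A.integrableOn)
  rw [add_zero] at hV hV'
  refine P.eq_zero_of_isLittleO (P.solvesODE_add_volterraOp i₁ i₂ hd) (h.add hV)
    ((h'.add hV').congr' ?_ EventuallyEq.rfl) hx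
  filter_upwards [self_mem_nhdsWithin] with y hy
  exact (P.hasDerivAt_add_volterraOp i₁ i₂ hd hy).deriv.symm

theorem eq_zero_of_isLittleO_of_add (P : PrincipalPair v ω σ p)
    (A : AdmissibleWeight ω (fun x => x ^ σ) Q fun x => x ^ σ)
    (hd : SolvesODE (fun x => v x + Q x) d) (h : d =o[𝓝[>] (0 : ℝ)] fun x => x ^ σ)
    (h' : deriv d =o[𝓝[>] (0 : ℝ)] fun x => x ^ (σ - 1)) {x : ℝ} (hx : 0 < x) : d x = 0 := by
  obtain ⟨ρ, L, -, V, -⟩ := P.exists_volterraKernel P.weightPair A (add_pos hx one_pos)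
  obtain ⟨M, hM0, hM⟩ :=
    exists_norm_le_mul_of_isBigO A.continuousOn A.pos hd.continuousOn h.isBigO (x + 1)
  have hx' : x ∈ Ioo 0 (x + 1) := ⟨hx, lt_add_one x⟩
  have hzero : ∀ y ∈ Ioo 0 (x + 1),
      ‖d y + volterraOp 0 (fun s t => bisolution p s t * Q t) d y‖ ≤ y ^ σ * 0 := fun y hy => by
    rw [volterraOp_mul_right, P.add_volterraOp_eq_zero A hd h h' hy.1, norm_zero, mul_zero]
  have := V.norm_le_of_norm_add_volterraOp_le
    ((hd.continuousOn.mono Ioo_subset_Ioi_self).aestronglyMeasurable measurableSet_Ioo) hM0 le_rfl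
    (ae_restrict_of_forall_mem measurableSet_Ioo hM)
    (ae_restrict_of_forall_mem measurableSet_Ioo hzero) hx' (hzero x hx')
  rwa [zero_mul, mul_zero, norm_le_zero_iff] at this

end PrincipalPair

/-! ### Existence and uniqueness for the perturbed equation -/

theorem besselPotential_eq_add (m k : ℂ) (Q : ℝ → ℂ) :
    besselPotential m k Q = fun x => besselPotential m k 0 x + Q x := by
  ext x
  simp [besselPotential]

theorem besselPotential_eq_zero_add (m k : ℂ) (Q : ℝ → ℂ) :
    besselPotential m k Q = fun x => besselPotential m 0 0 x + (Q x + k ^ 2) := by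
  rw [besselPotential_eq_add, besselPotential_zero_right]
  ext x
  ring

theorem IsInverseImage.add_volterraOp_eq {m k : ℂ} {Q g₀ g : ℝ → ℂ} {φ : ℝ → ℝ}
    (I : IsInverseImage m k Q φ g₀ g) {x : ℝ} (hx : 0 < x) :
    g x + volterraOp 0 (bisolution (fundamentalPair m k)) (fun y => Q y * g y) x = g₀ x := by
  rw [← I.eq x hx, greenQ_eq_volterraOp hx, volterraOp_mul_right]

namespace TamePair

variable {m k : ℂ} {Q g₀ g : ℝ → ℂ} {ω η φ : ℝ → ℝ}

section

variable (T : TamePair (besselPotential m k 0) ω η (fundamentalPair m k)) (hW : WeightPair ω η)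
  (A : AdmissibleWeight ω η Q φ)
include T hW A

theorem exists_isInverseImage (hg₀ : ContinuousOn g₀ (Ioi 0)) (hO : g₀ =O[𝓝[>] (0 : ℝ)] φ) :
    ∃ g, IsInverseImage m k Q φ g₀ g := by
  have hmem₀ : ∀ a, 0 < a → g₀ ∈ weightedLinfty a φ := fun a _ =>
    mem_weightedLinfty_of_isBigO A.pos A.continuousOn hg₀ hO a
  obtain ⟨g, hmem, hg⟩ := T.exists_add_volterraOp_eq hW A hmem₀
  refine ⟨g, fun a ha => ?_, hmem₀, hmem, fun x hx => ?_⟩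
  · obtain ⟨ρ, L, hL0, V, hL⟩ := T.exists_volterraKernel hW A ha
    exact oneAddGreenInvertible_of_volterraKernel V hL A.continuousOn A.pos hL0
  · rw [greenQ_eq_volterraOp hx, hg x hx]

theorem hasDerivAt_of_isInverseImage (hg₀ : IsSolution m k 0 g₀)
    (I : IsInverseImage m k Q φ g₀ g) {x : ℝ} (hx : 0 < x) : HasDerivAt g
      (deriv g₀ x -
        volterraOp 0 (bisolutionDeriv (fundamentalPair m k)) (fun y => Q y * g y) x) x :=
  T.hasDerivAt_of_add_volterraOp_eq
    (fun _ => T.intervalIntegrable_mul hW A I.mem T.fst)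
    (fun _ => T.intervalIntegrable_mul hW A I.mem T.snd)
    (isSolution_iff_solvesODE.1 hg₀) (fun _ => I.add_volterraOp_eq) hx

theorem isSolution_of_isInverseImage (hg₀ : IsSolution m k 0 g₀)
    (I : IsInverseImage m k Q φ g₀ g) : IsSolution m k Q g := by
  rw [isSolution_iff_solvesODE, besselPotential_eq_add]
  exact T.solvesODE_of_add_volterraOp_eq
    (fun _ => T.intervalIntegrable_mul hW A I.mem T.fst)
    (fun _ => T.intervalIntegrable_mul hW A I.mem T.snd)
    (isSolution_iff_solvesODE.1 hg₀) (fun _ => I.add_volterraOp_eq)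

end

theorem matchesNearZero_of_isInverseImage {σ ε : ℝ}
    (T : TamePair (besselPotential m k 0) ω (fun x => x ^ σ) (fundamentalPair m k))
    (hW : WeightPair ω fun x => x ^ σ) (A : AdmissibleWeight ω (fun x => x ^ σ) Q φ)
    (hε : 0 ≤ ε) (hi : IntegrableOn (fun y => y ^ (-ε) * (ω y * φ y * ‖Q y‖)) (Ioo 0 1))
    (hg₀ : IsSolution m k 0 g₀) (I : IsInverseImage m k Q φ g₀ g) :
    MatchesNearZero g₀ (σ + ε) g := by
  obtain ⟨h, h'⟩ := T.isLittleO_volterraOp hW A (I.mem 1 one_pos) hε hi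
  refine ⟨h.neg_left.congr' ?_ EventuallyEq.rfl, h'.neg_left.congr' ?_ EventuallyEq.rfl⟩
  · filter_upwards [self_mem_nhdsWithin] with x hx
    rw [← I.add_volterraOp_eq hx, sub_add_cancel_left]
  · filter_upwards [self_mem_nhdsWithin] with x hx
    rw [(T.hasDerivAt_of_isInverseImage hW A hg₀ I hx).deriv, sub_sub_cancel_left]

end TamePair

theorem MatchesNearZero.mono {g₀ g : ℝ → ℂ} {σ τ : ℝ} (h : MatchesNearZero g₀ τ g) (hστ : σ ≤ τ) :
    MatchesNearZero g₀ σ g :=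
  ⟨h.1.trans_isBigO (isBigO_rpow_rpow_nhdsGT_zero hστ),
    h.2.trans_isBigO (isBigO_rpow_rpow_nhdsGT_zero (sub_le_sub_right hστ 1))⟩

namespace PrincipalPair

variable {m : ℂ} {ω φ : ℝ → ℝ} {σ : ℝ} {p : (ℝ → ℂ) × (ℝ → ℂ)} {Q g₀ : ℝ → ℂ}
  (P : PrincipalPair (besselPotential m 0 0) ω σ p)
include P

theorem isBigO_of_isSolution {k : ℂ} (hg₀ : IsSolution m k 0 g₀) : g₀ =O[𝓝[>] (0 : ℝ)] ω := by
  obtain ⟨C, -, hC⟩ := (tamePair_fundamentalPair P.toTamePair P.weightPair k).exists_norm_le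
    P.weightPair (isSolution_iff_solvesODE.1 hg₀) one_pos
  refine IsBigO.of_bound C ?_
  filter_upwards [Ioo_mem_nhdsGT (zero_lt_one (α := ℝ))] with x hx
  rw [Real.norm_of_nonneg (P.weightPair.pos_left x hx.1).le]
  exact hC x hx

theorem eqOn_of_matchesNearZero {k : ℂ} (A : AdmissibleWeight ω (fun x => x ^ σ) Q φ) {f g : ℝ → ℂ}
    (hf : IsSolution m k Q f) (hfm : MatchesNearZero g₀ σ f) (hg : IsSolution m k Q g)
    (hgm : MatchesNearZero g₀ σ g) : EqOn f g (Ioi 0) := by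
  rw [isSolution_iff_solvesODE, besselPotential_eq_zero_add] at hf hg
  have A' := (A.self P.weightPair).add_const P.weightPair (k ^ 2)
  refine fun x hx => sub_eq_zero.1 (P.eq_zero_of_isLittleO_of_add A' (hf.sub hg)
    ((hfm.1.sub hgm.1).congr_left fun y => sub_sub_sub_cancel_right _ _ _)
    ((hfm.2.sub hgm.2).congr' ?_ EventuallyEq.rfl) hx)
  filter_upwards [self_mem_nhdsWithin] with y hy
  rw [sub_sub_sub_cancel_right]
  exact ((hf.hasDerivAt hy).sub (hg.hasDerivAt hy)).deriv.symm

end PrincipalPair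

theorem integrableOn_of_rpow_neg_mul {F : ℝ → ℝ} {ε : ℝ} (hε : 0 ≤ ε)
    (h : IntegrableOn (fun y => y ^ (-ε) * F y) (Ioo 0 1)) : IntegrableOn F (Ioo 0 1) := by
  refine IntegrableOn.congr_fun (f := fun y => y ^ ε * (y ^ (-ε) * F y)) ?_ (fun y hy => ?_)
    measurableSet_Ioo
  · have hmeas : Measurable fun y : ℝ => y ^ ε := by fun_prop
    refine h.bdd_mul (c := 1) hmeas.aestronglyMeasurable
      (ae_restrict_of_forall_mem measurableSet_Ioo fun y hy => ?_)
    rw [Real.norm_of_nonneg (Real.rpow_nonneg hy.1.le _)]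
    exact Real.rpow_le_one hy.1.le hy.2.le hε
  · beta_reduce
    rw [← mul_assoc, ← Real.rpow_add hy.1, add_neg_cancel, Real.rpow_zero, one_mul]

theorem PrincipalPair.exists_isUniqueMatchingSolution {m k : ℂ} {ω φ : ℝ → ℝ} {σ ε : ℝ}
    {p : (ℝ → ℂ) × (ℝ → ℂ)} {Q g₀ : ℝ → ℂ} (P : PrincipalPair (besselPotential m 0 0) ω σ p)
    (hQ : LocallyIntegrableOn Q (Ioi 0)) (hφ : ContinuousOn φ (Ioi 0)) (hφ0 : ∀ x, 0 < x → 0 < φ x)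
    (hσφ : (fun x => x ^ σ) =O[𝓝[>] (0 : ℝ)] φ) (hε : 0 ≤ ε)
    (hi : IntegrableOn (fun y => y ^ (-ε) * (ω y * φ y * ‖Q y‖)) (Ioo 0 1))
    (hg₀ : IsSolution m k 0 g₀) (hO : g₀ =O[𝓝[>] (0 : ℝ)] φ) :
    ∃ g, IsInverseImage m k Q φ g₀ g ∧ IsUniqueMatchingSolution m k Q g₀ (σ + ε) g := by
  have hW := P.weightPair
  have T := tamePair_fundamentalPair P.toTamePair hW k
  have A : AdmissibleWeight ω (fun x => x ^ σ) Q φ :=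
    ⟨hQ, hφ, hφ0, hσφ, integrableOn_of_rpow_neg_mul hε hi⟩
  obtain ⟨g, I⟩ := T.exists_isInverseImage hW A (isSolution_iff_solvesODE.1 hg₀).continuousOn hO
  have hg := T.isSolution_of_isInverseImage hW A hg₀ I
  have hgm := T.matchesNearZero_of_isInverseImage hW A hε hi hg₀ I
  have hσε : σ ≤ σ + ε := le_add_of_nonneg_right hε
  exact ⟨g, I, hg, hgm, fun f hf hfm =>
    P.eqOn_of_matchesNearZero A hf (hfm.mono hσε) hg (hgm.mono hσε)⟩

/-! ### Model solutions for `k = 0` and `m ≠ 0` -/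

theorem norm_bisolution_le (h : (ℝ → ℂ) × (ℝ → ℂ)) (x y : ℝ) : ‖bisolution h x y‖ ≤
    (‖h.1 x‖ * ‖h.2 y‖ + ‖h.2 x‖ * ‖h.1 y‖) / ‖wronskian h.1 h.2 1‖ := by
  rw [bisolution, norm_div, ← norm_mul, ← norm_mul]
  gcongr
  exact norm_sub_le _ _

theorem norm_bisolutionDeriv_le (h : (ℝ → ℂ) × (ℝ → ℂ)) (x y : ℝ) : ‖bisolutionDeriv h x y‖ ≤
    (‖deriv h.1 x‖ * ‖h.2 y‖ + ‖deriv h.2 x‖ * ‖h.1 y‖) / ‖wronskian h.1 h.2 1‖ := by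
  rw [bisolutionDeriv, norm_div, ← norm_mul, ← norm_mul]
  gcongr
  exact norm_sub_le _ _

theorem hasDerivAt_ofReal_cpow_of_pos (s : ℂ) {x : ℝ} (hx : 0 < x) :
    HasDerivAt (fun x : ℝ => (x : ℂ) ^ s) (s * (x : ℂ) ^ (s - 1)) x := by
  simpa using ((hasDerivAt_id (x : ℂ)).cpow_const (c := s)
    (Complex.ofReal_mem_slitPlane.2 hx)).comp_ofReal

theorem solvesODE_cpow {m s : ℂ} (hs : s * (s - 1) = m ^ 2 - 1 / 4) :
    SolvesODE (besselPotential m 0 0) (fun x : ℝ => (x : ℂ) ^ s) := by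
  have hderiv : ∀ x : ℝ, 0 < x → HasDerivAt (fun x : ℝ => s * (x : ℂ) ^ (s - 1))
      (s * ((s - 1) * (x : ℂ) ^ (s - 1 - 1))) x :=
    fun x hx => (hasDerivAt_ofReal_cpow_of_pos (s - 1) hx).const_mul s
  refine solvesODE_of_hasDerivAt (fun x hx => hasDerivAt_ofReal_cpow_of_pos s hx)
    (isAC_of_hasDerivAt hderiv fun x hx => ?_)
    (ae_restrict_of_forall_mem measurableSet_Ioi fun x hx => ?_)
  · exact (((hasDerivAt_ofReal_cpow_of_pos (s - 1 - 1) hx).continuousAt.const_mul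
      (s - 1)).const_mul s).continuousWithinAt
  · convert! hderiv x hx using 1
    have hx0 : (x : ℂ) ≠ 0 := Complex.ofReal_ne_zero.2 (ne_of_gt hx)
    rw [besselPotential, Complex.cpow_sub _ _ hx0, Complex.cpow_sub _ _ hx0, Complex.cpow_one, ← hs]
    simp only [Pi.zero_apply]
    field_simp
    ring

theorem norm_deriv_ofReal_cpow (s : ℂ) {x : ℝ} (hx : 0 < x) :
    ‖deriv (fun x : ℝ => (x : ℂ) ^ s) x‖ = ‖s‖ * (x ^ s.re / x) := by
  rw [(hasDerivAt_ofReal_cpow_of_pos s hx).deriv, norm_mul,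
    Complex.norm_cpow_eq_rpow_re_of_pos hx, Complex.sub_re, Complex.one_re,
    Real.rpow_sub_one hx.ne']

theorem isBigO_deriv_ofReal_cpow (s : ℂ) :
    deriv (fun x : ℝ => (x : ℂ) ^ s) =O[𝓝[>] (0 : ℝ)] fun x => x ^ (s.re - 1) := by
  refine IsBigO.of_bound ‖s‖ ?_
  filter_upwards [self_mem_nhdsWithin] with x hx
  rw [norm_deriv_ofReal_cpow s hx, ← Real.rpow_sub_one (ne_of_gt hx),
    Real.norm_of_nonneg (Real.rpow_nonneg (le_of_lt hx) _)]

theorem continuousOn_rpow_Ioi (s : ℝ) : ContinuousOn (fun x : ℝ => x ^ s) (Ioi 0) :=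
  fun x hx => (Real.continuousAt_rpow_const x s (Or.inl (ne_of_gt hx))).continuousWithinAt

/-- The solutions `x ^ (1/2 + m)` and `x ^ (1/2 - m)` of the equation with `k = 0` and `Q = 0`. -/
noncomputable def powerPair (m : ℂ) : (ℝ → ℂ) × (ℝ → ℂ) :=
  (fun x => (x : ℂ) ^ (1 / 2 + m), fun x => (x : ℂ) ^ (1 / 2 - m))

theorem wronskian_powerPair (m : ℂ) : wronskian (powerPair m).1 (powerPair m).2 1 = -2 * m := by
  simp only [wronskian, powerPair, (hasDerivAt_ofReal_cpow_of_pos _ one_pos).deriv,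
    Complex.ofReal_one, Complex.one_cpow]
  ring

theorem fundamentalSystem_powerPair {m : ℂ} (hm : m ≠ 0) :
    FundamentalSystem (besselPotential m 0 0) (powerPair m) :=
  ⟨solvesODE_cpow (by ring), solvesODE_cpow (by ring), by simpa [wronskian_powerPair] using hm⟩

section

variable (m : ℂ) {x : ℝ} (hx : 0 < x)
include hx

theorem norm_powerPair_fst : ‖(powerPair m).1 x‖ = x ^ (1 / 2 + m.re) := by
  rw [powerPair, Complex.norm_cpow_eq_rpow_re_of_pos hx]
  simp

theorem norm_powerPair_snd : ‖(powerPair m).2 x‖ = x ^ (1 / 2 - m.re) := by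
  rw [powerPair, Complex.norm_cpow_eq_rpow_re_of_pos hx]
  simp

theorem norm_deriv_powerPair_fst :
    ‖deriv (powerPair m).1 x‖ = ‖1 / 2 + m‖ * (x ^ (1 / 2 + m.re) / x) := by
  rw [powerPair, norm_deriv_ofReal_cpow _ hx]
  simp

theorem norm_deriv_powerPair_snd :
    ‖deriv (powerPair m).2 x‖ = ‖1 / 2 - m‖ * (x ^ (1 / 2 - m.re) / x) := by
  rw [powerPair, norm_deriv_ofReal_cpow _ hx]
  simp

end

theorem weightPair_power (μ : ℝ) :
    WeightPair (fun x => x ^ (1 / 2 - μ)) (fun x => x ^ (1 / 2 + μ)) := by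
  refine ⟨continuousOn_rpow_Ioi _, continuousOn_rpow_Ioi _, fun x hx => Real.rpow_pos_of_pos hx _,
    fun x hx => Real.rpow_pos_of_pos hx _, fun a ha => ⟨a, ha.le, fun x hx => ?_⟩⟩
  rw [← Real.rpow_add hx.1, show 1 / 2 + μ + (1 / 2 - μ) = 1 by ring, Real.rpow_one]
  exact hx.2.le

theorem rpow_sub_mul_rpow_add_le {c μ x y : ℝ} (hμ : 0 ≤ μ) (hy : 0 < y) (hyx : y ≤ x) :
    x ^ (c - μ) * y ^ (c + μ) ≤ y ^ (c - μ) * x ^ (c + μ) := by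
  have hx := hy.trans_le hyx
  have hsplit : ∀ {z : ℝ}, 0 < z → z ^ (c + μ) = z ^ (c - μ) * z ^ (2 * μ) := fun {z} hz => by
    rw [← Real.rpow_add hz]
    ring_nf
  rw [hsplit hx, hsplit hy, mul_left_comm]
  gcongr

section

variable {m : ℂ} (hm : 0 ≤ m.re) {x y : ℝ} (hy : 0 < y) (hyx : y ≤ x)
include hm hy hyx

theorem norm_bisolution_powerPair_le : ‖bisolution (powerPair m) x y‖ ≤
    2 / ‖2 * m‖ * (y ^ (1 / 2 - m.re) * x ^ (1 / 2 + m.re)) := by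
  have hx := hy.trans_le hyx
  refine (norm_bisolution_le _ x y).trans ?_
  rw [wronskian_powerPair, neg_mul, norm_neg, div_mul_eq_mul_div, norm_powerPair_fst m hx,
    norm_powerPair_fst m hy, norm_powerPair_snd m hx, norm_powerPair_snd m hy]
  gcongr
  linarith [rpow_sub_mul_rpow_add_le (c := 1 / 2) hm hy hyx]

theorem norm_bisolutionDeriv_powerPair_le : ‖bisolutionDeriv (powerPair m) x y‖ ≤
    (‖1 / 2 + m‖ + ‖1 / 2 - m‖) / ‖2 * m‖ *
      (y ^ (1 / 2 - m.re) * (x ^ (1 / 2 + m.re) / x)) := by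
  have hx := hy.trans_le hyx
  refine (norm_bisolutionDeriv_le _ x y).trans ?_
  rw [wronskian_powerPair, neg_mul, norm_neg, div_mul_eq_mul_div, norm_deriv_powerPair_fst m hx,
    norm_powerPair_fst m hy, norm_deriv_powerPair_snd m hx, norm_powerPair_snd m hy]
  gcongr
  calc ‖1 / 2 + m‖ * (x ^ (1 / 2 + m.re) / x) * y ^ (1 / 2 - m.re)
        + ‖1 / 2 - m‖ * (x ^ (1 / 2 - m.re) / x) * y ^ (1 / 2 + m.re)
      = (‖1 / 2 + m‖ * (y ^ (1 / 2 - m.re) * x ^ (1 / 2 + m.re))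
        + ‖1 / 2 - m‖ * (x ^ (1 / 2 - m.re) * y ^ (1 / 2 + m.re))) / x := by ring
    _ ≤ (‖1 / 2 + m‖ * (y ^ (1 / 2 - m.re) * x ^ (1 / 2 + m.re))
        + ‖1 / 2 - m‖ * (y ^ (1 / 2 - m.re) * x ^ (1 / 2 + m.re))) / x := by
      gcongr (_ + _ * ?_) / x
      exact rpow_sub_mul_rpow_add_le hm hy hyx
    _ = _ := by ring

end

theorem principalPair_power {m : ℂ} (hm : 0 ≤ m.re) (hm0 : m ≠ 0) :
    PrincipalPair (besselPotential m 0 0) (fun x => x ^ (1 / 2 - m.re)) (1 / 2 + m.re)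
      (powerPair m) where
  toFundamentalSystem := fundamentalSystem_powerPair hm0
  norm_bisolution_le a _ := by
    refine ⟨2 / ‖2 * m‖ + (‖1 / 2 + m‖ + ‖1 / 2 - m‖) / ‖2 * m‖, by positivity,
      fun x y hy hyx _ => ?_⟩
    have hx := hy.trans_le hyx
    constructor
    · refine (norm_bisolution_powerPair_le hm hy hyx).trans ?_
      gcongr
      exact le_add_of_nonneg_right (by positivity)
    · refine (norm_bisolutionDeriv_powerPair_le hm hy hyx).trans ?_
      gcongr
      exact le_add_of_nonneg_left (by positivity)
  weightPair := weightPair_power m.re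
  half_le := le_add_of_nonneg_right hm
  norm_fst _ := norm_powerPair_fst m
  isBigO_deriv_fst := by simpa [powerPair] using isBigO_deriv_ofReal_cpow (1 / 2 + m)

/-! ### Model solutions for `k = 0` and `m = 0` -/

/-- The solutions `x ^ (1/2)` and `x ^ (1/2) log x` of the equation with `k = 0`, `m = 0` and
`Q = 0`. -/
noncomputable def logPair : (ℝ → ℂ) × (ℝ → ℂ) :=
  (fun x => (x : ℂ) ^ (1 / 2 : ℂ), fun x => (x : ℂ) ^ (1 / 2 : ℂ) * (Real.log x : ℂ))

theorem logPair_snd (x : ℝ) : logPair.2 x = logPair.1 x * (Real.log x : ℂ) := rfl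

theorem solvesODE_logPair_fst : SolvesODE (besselPotential 0 0 0) logPair.1 :=
  solvesODE_cpow (by norm_num)

theorem hasDerivAt_ofReal_log {x : ℝ} (hx : 0 < x) :
    HasDerivAt (fun x : ℝ => (Real.log x : ℂ)) (1 / (x : ℂ)) x := by
  simpa using (Real.hasDerivAt_log hx.ne').ofReal_comp

theorem hasDerivAt_ofReal_inv {x : ℝ} (hx : 0 < x) :
    HasDerivAt (fun x : ℝ => (x : ℂ)⁻¹) (-((x : ℂ) ^ 2)⁻¹) x := by
  simpa using (hasDerivAt_inv hx.ne').ofReal_comp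

theorem continuousOn_ofReal_inv : ContinuousOn (fun x : ℝ => (x : ℂ)⁻¹) (Ioi 0) :=
  fun _ hx => (hasDerivAt_ofReal_inv hx).continuousAt.continuousWithinAt

theorem isAC_ofReal_log : IsAC fun x : ℝ => (Real.log x : ℂ) :=
  isAC_of_hasDerivAt (fun _ => hasDerivAt_ofReal_log)
    (continuousOn_ofReal_inv.congr fun _ _ => one_div _)

theorem isAC_ofReal_inv : IsAC fun x : ℝ => (x : ℂ)⁻¹ :=
  isAC_of_hasDerivAt (fun _ => hasDerivAt_ofReal_inv)
    ((continuousOn_ofReal_inv.pow 2).neg.congr fun _ _ => by simp)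

section

variable {x : ℝ} (hx : 0 < x)
include hx

theorem norm_logPair_fst : ‖logPair.1 x‖ = x ^ (1 / 2 : ℝ) := by
  rw [logPair, Complex.norm_cpow_eq_rpow_re_of_pos hx]
  norm_num

theorem deriv_logPair_fst : deriv logPair.1 x = 1 / 2 * (logPair.1 x / x) := by
  have hx0 : (x : ℂ) ≠ 0 := Complex.ofReal_ne_zero.2 hx.ne'
  rw [logPair, (hasDerivAt_ofReal_cpow_of_pos _ hx).deriv, Complex.cpow_sub _ _ hx0,
    Complex.cpow_one]

theorem hasDerivAt_logPair_snd :
    HasDerivAt logPair.2 (deriv logPair.1 x * (Real.log x : ℂ) + logPair.1 x * (x : ℂ)⁻¹) x := by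
  simpa only [one_div] using!
    (solvesODE_logPair_fst.hasDerivAt hx).mul (hasDerivAt_ofReal_log hx)

theorem deriv_logPair_snd :
    deriv logPair.2 x = logPair.1 x / x * (1 / 2 * (Real.log x : ℂ) + 1) := by
  rw [(hasDerivAt_logPair_snd hx).deriv, deriv_logPair_fst hx]
  ring

end

theorem solvesODE_logPair_snd : SolvesODE (besselPotential 0 0 0) logPair.2 := by
  have F := solvesODE_logPair_fst
  refine solvesODE_of_hasDerivAt (fun _ => hasDerivAt_logPair_snd)
    ((F.isAC_deriv.mul isAC_ofReal_log).add (F.isAC.mul isAC_ofReal_inv)) ?_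
  filter_upwards [F.eq, ae_restrict_mem measurableSet_Ioi] with x hderiv hx
  have hx0 : (x : ℂ) ≠ 0 := Complex.ofReal_ne_zero.2 (ne_of_gt hx)
  convert! (hderiv.mul (hasDerivAt_ofReal_log hx)).add
    ((F.hasDerivAt hx).mul (hasDerivAt_ofReal_inv hx)) using 1
  rw [deriv_logPair_fst hx, logPair_snd]
  field_simp
  ring

theorem wronskian_logPair : wronskian logPair.1 logPair.2 1 = 1 := by
  rw [wronskian, deriv_logPair_snd one_pos, logPair_snd]
  simp [logPair]

theorem fundamentalSystem_logPair : FundamentalSystem (besselPotential 0 0 0) logPair :=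
  ⟨solvesODE_logPair_fst, solvesODE_logPair_snd, by simp [wronskian_logPair]⟩

theorem rpow_half_mul_self {x : ℝ} (hx : 0 < x) : x ^ (1 / 2 : ℝ) * x ^ (1 / 2 : ℝ) = x := by
  rw [← Real.rpow_add hx, add_halves, Real.rpow_one]

theorem abs_log_le_add {x y a : ℝ} (hy : 0 < y) (hyx : y ≤ x) (hxa : x ≤ a) :
    |Real.log x| ≤ |Real.log y| + |Real.log a| := by
  have hyx' := Real.log_le_log hy hyx
  have hxa' := Real.log_le_log (hy.trans_le hyx) hxa
  rw [abs_le]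
  constructor
  · linarith [neg_abs_le (Real.log y), abs_nonneg (Real.log a)]
  · linarith [le_abs_self (Real.log a), abs_nonneg (Real.log y)]

theorem mul_one_add_abs_log_le {x a : ℝ} (hx : 0 < x) (hxa : x ≤ a) :
    x * (1 + |Real.log x|) ≤ 1 + a * (1 + |Real.log a|) := by
  have ha : 0 ≤ a := hx.le.trans hxa
  rw [mul_add, mul_add, mul_one, mul_one]
  rcases le_total x 1 with hx1 | hx1
  · have hlog := (Real.abs_log_mul_self_lt x hx hx1).le
    rw [abs_mul, abs_of_pos hx] at hlog
    have : 0 ≤ a * |Real.log a| := by positivity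
    linarith
  · have hlog := abs_log_le_add one_pos hx1 hxa
    rw [Real.log_one, abs_zero, zero_add] at hlog
    have : x * |Real.log x| ≤ a * |Real.log a| := by gcongr
    linarith

theorem weightPair_log :
    WeightPair (fun x => x ^ (1 / 2 : ℝ) * (1 + |Real.log x|)) (fun x => x ^ (1 / 2 : ℝ)) where
  continuousOn_left := (continuousOn_rpow_Ioi _).mul
    (continuousOn_const.add (Real.continuousOn_log.mono fun _ hx => ne_of_gt hx).abs)
  continuousOn_right := continuousOn_rpow_Ioi _
  pos_left x hx := by positivity
  pos_right x hx := Real.rpow_pos_of_pos hx _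
  mul_le a ha := ⟨1 + a * (1 + |Real.log a|), by positivity, fun x hx => by
    rw [← mul_assoc, rpow_half_mul_self hx.1]
    exact mul_one_add_abs_log_le hx.1 hx.2.le⟩

theorem bisolution_logPair (x y : ℝ) : bisolution logPair x y =
    logPair.1 x * logPair.1 y * ((Real.log y : ℂ) - (Real.log x : ℂ)) := by
  rw [bisolution, wronskian_logPair, div_one, logPair_snd, logPair_snd]
  ring

theorem bisolutionDeriv_logPair {x : ℝ} (hx : 0 < x) (y : ℝ) : bisolutionDeriv logPair x y =
    logPair.1 x * logPair.1 y * (1 / 2 * ((Real.log y : ℂ) - (Real.log x : ℂ)) - 1) / x := by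
  rw [bisolutionDeriv, wronskian_logPair, div_one, deriv_logPair_fst hx, deriv_logPair_snd hx,
    logPair_snd]
  ring

section

variable {x y a : ℝ} (hy : 0 < y) (hyx : y ≤ x) (hxa : x ≤ a)
include hy hyx hxa

theorem norm_log_sub_log_le : ‖(Real.log y : ℂ) - (Real.log x : ℂ)‖ ≤
    (2 + |Real.log a|) * (1 + |Real.log y|) := by
  rw [← Complex.ofReal_sub, Complex.norm_real, Real.norm_eq_abs]
  refine (abs_sub _ _).trans ?_
  nlinarith [abs_log_le_add hy hyx hxa, abs_nonneg (Real.log a), abs_nonneg (Real.log y)]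

theorem norm_bisolution_logPair_le : ‖bisolution logPair x y‖ ≤
    (2 + |Real.log a|) * (y ^ (1 / 2 : ℝ) * (1 + |Real.log y|) * x ^ (1 / 2 : ℝ)) := by
  have hx := hy.trans_le hyx
  rw [bisolution_logPair, norm_mul, norm_mul, norm_logPair_fst hx, norm_logPair_fst hy]
  calc _ ≤ x ^ (1 / 2 : ℝ) * y ^ (1 / 2 : ℝ) * ((2 + |Real.log a|) * (1 + |Real.log y|)) := by
        gcongr
        exact norm_log_sub_log_le hy hyx hxa
    _ = _ := by ring

theorem norm_bisolutionDeriv_logPair_le : ‖bisolutionDeriv logPair x y‖ ≤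
    (2 + |Real.log a|) * (y ^ (1 / 2 : ℝ) * (1 + |Real.log y|) * (x ^ (1 / 2 : ℝ) / x)) := by
  have hx := hy.trans_le hyx
  have hlog : ‖1 / 2 * ((Real.log y : ℂ) - (Real.log x : ℂ)) - 1‖ ≤
      (2 + |Real.log a|) * (1 + |Real.log y|) := by
    refine (norm_sub_le _ _).trans ?_
    rw [norm_mul, norm_one, show ‖(1 / 2 : ℂ)‖ = 1 / 2 by norm_num]
    nlinarith [norm_log_sub_log_le hy hyx hxa, abs_nonneg (Real.log a), abs_nonneg (Real.log y)]
  rw [bisolutionDeriv_logPair hx, norm_div, norm_mul, norm_mul, norm_logPair_fst hx,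
    norm_logPair_fst hy, Complex.norm_real, Real.norm_of_nonneg hx.le]
  calc _ ≤ x ^ (1 / 2 : ℝ) * y ^ (1 / 2 : ℝ) * ((2 + |Real.log a|) * (1 + |Real.log y|)) / x := by
        gcongr
    _ = _ := by ring

end

theorem principalPair_log :
    PrincipalPair (besselPotential 0 0 0) (fun x => x ^ (1 / 2 : ℝ) * (1 + |Real.log x|)) (1 / 2)
      logPair where
  toFundamentalSystem := fundamentalSystem_logPair
  norm_bisolution_le a _ := ⟨2 + |Real.log a|, by positivity, fun _ _ hy hyx hxa =>
    ⟨norm_bisolution_logPair_le hy hyx hxa.le, norm_bisolutionDeriv_logPair_le hy hyx hxa.le⟩⟩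
  weightPair := weightPair_log
  half_le := le_rfl
  norm_fst _ := norm_logPair_fst
  isBigO_deriv_fst := by simpa [logPair] using isBigO_deriv_ofReal_cpow (1 / 2)

/-! ### The classes of potentials -/

section

variable {ε : ℝ} {Q : ℝ → ℂ}

theorem integrableOn_rpow_mul_of_mem_potentialClass (hQ : Q ∈ potentialClass ε) {s t δ : ℝ}
    (h : -δ + (s + t) = 1 - ε) :
    IntegrableOn (fun y => y ^ (-δ) * (y ^ s * y ^ t * ‖Q y‖)) (Ioo 0 1) := by
  refine hQ.2.congr_fun (fun y hy => ?_) measurableSet_Ioo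
  beta_reduce
  rw [← mul_assoc, ← Real.rpow_add hy.1, ← Real.rpow_add hy.1, h]

theorem rpow_neg_mul_rpow_half_mul_self {y : ℝ} (hy : 0 < y) :
    y ^ (-ε) * (y ^ (1 / 2 : ℝ) * y ^ (1 / 2 : ℝ)) = y ^ (1 - ε) := by
  rw [rpow_half_mul_self hy, sub_eq_neg_add, Real.rpow_add_one hy.ne']

theorem integrableOn_log_mul_of_mem_logPotentialClass (hQ : Q ∈ logPotentialClass ε 1) :
    IntegrableOn (fun y => y ^ (-ε) *
      (y ^ (1 / 2 : ℝ) * (1 + |Real.log y|) * y ^ (1 / 2 : ℝ) * ‖Q y‖)) (Ioo 0 1) := by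
  refine hQ.2.congr_fun (fun y hy => ?_) measurableSet_Ioo
  simp only [Real.rpow_one, ← rpow_neg_mul_rpow_half_mul_self hy.1]
  ring

theorem integrableOn_log_mul_log_of_mem_logPotentialClass (hQ : Q ∈ logPotentialClass ε 2) :
    IntegrableOn (fun y => y ^ (-ε) *
      (y ^ (1 / 2 : ℝ) * (1 + |Real.log y|) * (y ^ (1 / 2 : ℝ) * (1 + |Real.log y|)) * ‖Q y‖))
      (Ioo 0 1) := by
  have hmeas : AEStronglyMeasurable (fun y => ‖Q y‖) (volume.restrict (Ioo 0 1)) :=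
    (hQ.1.aestronglyMeasurable.mono_set Ioo_subset_Ioi_self).norm
  refine (hQ.2.const_mul 2).mono' (by fun_prop)
    (ae_restrict_of_forall_mem measurableSet_Ioo fun y hy => ?_)
  have hy0 := hy.1
  have hsq : (1 + |Real.log y|) ^ 2 ≤ 2 * (1 + |Real.log y| ^ (2 : ℝ)) := by
    rw [Real.rpow_two]
    nlinarith [sq_nonneg (1 - |Real.log y|)]
  rw [Real.norm_of_nonneg (by positivity), ← rpow_neg_mul_rpow_half_mul_self hy0]
  calc _ = y ^ (-ε) * (y ^ (1 / 2 : ℝ) * y ^ (1 / 2 : ℝ)) * (1 + |Real.log y|) ^ 2 * ‖Q y‖ := by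
        ring
    _ ≤ y ^ (-ε) * (y ^ (1 / 2 : ℝ) * y ^ (1 / 2 : ℝ)) *
        (2 * (1 + |Real.log y| ^ (2 : ℝ))) * ‖Q y‖ := by gcongr
    _ = _ := by ring

end

theorem isBigO_mul_one_add_abs_log {l : Filter ℝ} (f : ℝ → ℝ) :
    f =O[l] fun x => f x * (1 + |Real.log x|) := by
  refine IsBigO.of_bound' (Eventually.of_forall fun x => ?_)
  rw [norm_mul, Real.norm_of_nonneg (r := 1 + |Real.log x|) (by positivity)]
  exact le_mul_of_one_le_right (norm_nonneg _) (le_add_of_nonneg_right (abs_nonneg _))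

end PerturbedBessel

theorem mainTheorem1 (k : ℂ) (hk : 0 ≤ k.re) (Q : ℝ → ℂ) (ε : ℝ) :
    -- principal `g₀`, `m ≠ 0`
    (∀ m : ℂ, 0 ≤ m.re → m ≠ 0 → 0 ≤ ε → Q ∈ PerturbedBessel.potentialClass ε →
      ∀ g₀ : ℝ → ℂ, PerturbedBessel.IsSolution m k 0 g₀ →
        g₀ =O[𝓝[>] (0 : ℝ)] (fun x : ℝ => x ^ (1 / 2 + m.re)) →
        ∃ g : ℝ → ℂ,
          PerturbedBessel.IsInverseImage m k Q (fun x => x ^ (1 / 2 + m.re)) g₀ g ∧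
          PerturbedBessel.IsUniqueMatchingSolution m k Q g₀ (1 / 2 + m.re + ε) g) ∧
    -- principal `g₀`, `m = 0`
    (0 ≤ ε → Q ∈ PerturbedBessel.logPotentialClass ε 1 →
      ∀ g₀ : ℝ → ℂ, PerturbedBessel.IsSolution 0 k 0 g₀ →
        g₀ =O[𝓝[>] (0 : ℝ)] (fun x : ℝ => x ^ (1 / 2 : ℝ)) →
        ∃ g : ℝ → ℂ,
          PerturbedBessel.IsInverseImage 0 k Q (fun x => x ^ (1 / 2 : ℝ)) g₀ g ∧
          PerturbedBessel.IsUniqueMatchingSolution 0 k Q g₀ (1 / 2 + ε) g) ∧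
    -- arbitrary `g₀`, `m ≠ 0`
    (∀ m : ℂ, 0 ≤ m.re → m ≠ 0 → 2 * m.re ≤ ε → Q ∈ PerturbedBessel.potentialClass ε →
      ∀ g₀ : ℝ → ℂ, PerturbedBessel.IsSolution m k 0 g₀ →
        ∃ g : ℝ → ℂ,
          PerturbedBessel.IsInverseImage m k Q (fun x => x ^ (1 / 2 - m.re)) g₀ g ∧
          PerturbedBessel.IsUniqueMatchingSolution m k Q g₀ (1 / 2 - m.re + ε) g) ∧
    -- arbitrary `g₀`, `m = 0`
    (0 ≤ ε → Q ∈ PerturbedBessel.logPotentialClass ε 2 →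
      ∀ g₀ : ℝ → ℂ, PerturbedBessel.IsSolution 0 k 0 g₀ →
        ∃ g : ℝ → ℂ,
          PerturbedBessel.IsInverseImage 0 k Q
            (fun x => x ^ (1 / 2 : ℝ) * (1 + |Real.log x|)) g₀ g ∧
          PerturbedBessel.IsUniqueMatchingSolution 0 k Q g₀ (1 / 2 + ε) g) := by
  open PerturbedBessel in
  refine ⟨fun m hm hm0 hε hQ g₀ hg₀ hO => ?_, fun hε hQ g₀ hg₀ hO => ?_,
    fun m hm hm0 hε hQ g₀ hg₀ => ?_, fun hε hQ g₀ hg₀ => ?_⟩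
  · have P := principalPair_power hm hm0
    exact P.exists_isUniqueMatchingSolution hQ.1 P.weightPair.continuousOn_right
      P.weightPair.pos_right (isBigO_refl _ _) hε
      (integrableOn_rpow_mul_of_mem_potentialClass hQ (by ring)) hg₀ hO
  · have P := principalPair_log
    exact P.exists_isUniqueMatchingSolution hQ.1 P.weightPair.continuousOn_right
      P.weightPair.pos_right (isBigO_refl _ _) hε
      (integrableOn_log_mul_of_mem_logPotentialClass hQ) hg₀ hO
  · have P := principalPair_power hm hm0
    have hexp : 1 / 2 - m.re + ε = 1 / 2 + m.re + (ε - 2 * m.re) := by ring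
    rw [hexp]
    exact P.exists_isUniqueMatchingSolution hQ.1 P.weightPair.continuousOn_left
      P.weightPair.pos_left (isBigO_rpow_rpow_nhdsGT_zero (by linarith)) (sub_nonneg.2 hε)
      (integrableOn_rpow_mul_of_mem_potentialClass hQ (by ring)) hg₀ (P.isBigO_of_isSolution hg₀)
  · have P := principalPair_log
    exact P.exists_isUniqueMatchingSolution hQ.1 P.weightPair.continuousOn_left
      P.weightPair.pos_left (isBigO_mul_one_add_abs_log _) hε
      (integrableOn_log_mul_log_of_mem_logPotentialClass hQ) hg₀ (P.isBigO_of_isSolution hg₀)
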